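/- Let $1\le N\le M$ and let $H\in\mathbb{C}^{N\times M}$ be a random channel matrix ($M$ transmit, $N$ receive antennas) with i.i.d. $\mathcal{CN}(0,1)$ entries. For $\rho>0$ put $F=H^{H}H+\frac{N}{\rho}I_M$, $\beta=\big(\operatorname{tr}(F^{-2}H^{H}H)\big)^{-1/2}$, and let $T=\beta F^{-1}H^{H}$ be the transmit Wiener filter precoder. Let $\mathbb{H}=HT\in\mathbb{C}^{N\times N}$ be the composite channel and $W=(\mathbb{H}^{H}\mathbb{H})^{-1}\mathbb{H}^{H}$ its zero-forcing equalizer. In the system $y=WHTx+Wn$, where $x$ and $n$ are independent and zero-mean, $\mathbb{E}[xx^{H}]=\frac{\rho}{N}I_N$, and $n$ is complex Gaussian with $\mathbb{E}[nn^{H}]=I_N$, let $$\gamma_k=\frac{\frac{\rho}{N}\,|(WHT)_{kk}|^2}{\frac{\rho}{N}\sum_{i\ne k}|(WHT)_{ki}|^2+(WW^{H})_{kk}},\qquad k=1,\dots,N,$$ be the SINR of the $k$-th stream given $H$, and for a fixed rate $R>0$ (independent of $\rho$) let $$P_{\mathrm{out}}(\rho)=\Pr\Big(\sum_{k=1}^{N}\log_2(1+\gamma_k)\le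 R\Big)$$ be the outage probability. Write $f\doteq g$ if $f$ and $g$ are positive for all large $\rho$ and $\lim_{\rho\to\infty}\frac{\log f(\rho)}{\log\rho}$ and $\lim_{\rho\to\infty}\frac{\log g(\rho)}{\log\rho}$ exist and are equal. Then, for every $R>0$, $$P_{\mathrm{out}}(\rho)\doteq\rho^{-(M-N+1)};$$ that is, the diversity at every rate $R>0$ is $$d^{\mathrm{WFP\text{-}ZF}}=-\lim_{\rho\to\infty}\frac{\log P_{\mathrm{out}}(\rho)}{\log\rho}=M-N+1 .$$ -/

import Mathlib

open MeasureTheory ProbabilityTheory Filter Topology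
open scoped Matrix NNReal

noncomputable section

namespace MIMO

/-- The circularly symmetric complex Gaussian law `CN(0,1)`: real and imaginary parts are
independent centred real Gaussians of variance `1/2`. -/
def stdComplexGaussian : Measure ℂ :=
  ((gaussianReal 0 (1 / 2 : ℝ≥0)).prod (gaussianReal 0 (1 / 2 : ℝ≥0))).map
    Complex.measurableEquivRealProd.symm

/-- The random `N × M` channel matrix `H` (`N` receive and `M` transmit antennas) has i.i.d.
`CN(0,1)` entries. -/
structure IsGaussianChannel {Ω : Type*} [MeasurableSpace Ω] {N M : ℕ}
    (H : Ω → Matrix (Fin N) (Fin M) ℂ) (P : Measure Ω) : Prop where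
  law : ∀ i j, HasLaw (fun ω => H ω i j) stdComplexGaussian P
  indep : iIndepFun (fun (p : Fin N × Fin M) ω => H ω p.1 p.2) P

section Filters

variable {M N B : ℕ}

/-- The matrix `F = Hᴴ H + (N/ρ) I` of the transmit Wiener filter. -/
def wienerF (ρ : ℝ) (H : Matrix (Fin N) (Fin M) ℂ) : Matrix (Fin M) (Fin M) ℂ :=
  Hᴴ * H + (((N : ℝ) / ρ : ℝ) : ℂ) • (1 : Matrix (Fin M) (Fin M) ℂ)

/-- The scaling factor `β = (tr (F⁻² Hᴴ H))^(-1/2)`; the trace is a nonnegative real number. -/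
def wienerBeta (ρ : ℝ) (H : Matrix (Fin N) (Fin M) ℂ) : ℝ :=
  Real.sqrt (1 / (Matrix.trace ((wienerF ρ H)⁻¹ ^ 2 * (Hᴴ * H))).re)

/-- The transmit Wiener filter precoder `T = β F⁻¹ Hᴴ`. -/
def wienerPrecoder (ρ : ℝ) (H : Matrix (Fin N) (Fin M) ℂ) : Matrix (Fin M) (Fin N) ℂ :=
  ((wienerBeta ρ H : ℝ) : ℂ) • ((wienerF ρ H)⁻¹ * Hᴴ)

/-- The zero-forcing equalizer `(Gᴴ G)⁻¹ Gᴴ` of a channel `G`. -/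
def zfEqualizer (G : Matrix (Fin N) (Fin B) ℂ) : Matrix (Fin B) (Fin N) ℂ :=
  (Gᴴ * G)⁻¹ * Gᴴ

/-- The SINR of stream `k` in `y = W H T x + W n`, where `E[x xᴴ] = (ρ/B) I` for the `B` streams
and the receiver noise `n` is white of unit variance: desired power over interference power plus
filtered noise power `(W Wᴴ)ₖₖ`. -/
def sinr (ρ : ℝ) (H : Matrix (Fin N) (Fin M) ℂ) (T : Matrix (Fin M) (Fin B) ℂ)
    (W : Matrix (Fin B) (Fin N) ℂ) (k : Fin B) : ℝ :=
  (ρ / B * ‖(W * H * T) k k‖ ^ 2) /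
    (ρ / B * ∑ i ∈ Finset.univ.erase k, ‖(W * H * T) k i‖ ^ 2 + ∑ j, ‖W k j‖ ^ 2)

/-- The SINR of stream `k` for Wiener precoding followed by the zero-forcing equalizer of the
composite channel `H T`. -/
def sinrWienerZF (ρ : ℝ) (H : Matrix (Fin N) (Fin M) ℂ) (k : Fin N) : ℝ :=
  sinr ρ H (wienerPrecoder ρ H) (zfEqualizer (H * wienerPrecoder ρ H)) k

end Filters

/-- Outage probability at rate `R` (bits/s/Hz) under joint spatial encoding:
`Pr(∑ₖ log₂ (1 + γₖ) ≤ R)`. -/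
def outageProb {Ω : Type*} [MeasurableSpace Ω] {B : ℕ} (P : Measure Ω) (γ : Ω → Fin B → ℝ)
    (R : ℝ) : ℝ :=
  P.real {ω | ∑ k, Real.logb 2 (1 + γ ω k) ≤ R}

/-- Exponential equality `f ≐ g`: `lim log f(ρ) / log ρ = lim log g(ρ) / log ρ` as `ρ → ∞`
(both limits exist, and both functions are eventually positive). -/
def ExpEq (f g : ℝ → ℝ) : Prop :=
  (∀ᶠ ρ in atTop, 0 < f ρ) ∧ (∀ᶠ ρ in atTop, 0 < g ρ) ∧
    ∃ l : ℝ, Tendsto (fun ρ => Real.log (f ρ) / Real.log ρ) atTop (𝓝 l) ∧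
      Tendsto (fun ρ => Real.log (g ρ) / Real.log ρ) atTop (𝓝 l)

/-- `d` is the diversity of the outage probability `p`: `d = - lim log p(ρ) / log ρ`. -/
def HasDiversity (p : ℝ → ℝ) (d : ℝ) : Prop :=
  (∀ᶠ ρ in atTop, 0 < p ρ) ∧
    Tendsto (fun ρ => -(Real.log (p ρ) / Real.log ρ)) atTop (𝓝 d)

end MIMO

end

/-! Write `H * Hᴴ = U diag(l) Uᴴ` and `c = N / ρ`. The composite channel is `β U diag(l / (l + c))
Uᴴ`; zero forcing inverts it, interference disappears, and stream `k` has SINR `(ρ / N) / (τ ∑ᵢ |U k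
i|² (1 + c / l i)²)` with `τ = ∑ᵢ l i / (l i + c)²` (`sinrWienerZF_eq`). Everything depends on
whether some `l i` is of order `1 / ρ`.

Upper bound. Outage forces some `l i ≤ const / ρ` (`exists_unit_of_outage`), so a unit row
combination of `H` has norm at most `s`, with `s² ~ 1 / ρ`. Scale its largest coefficient to `1` and
round the others to an `s`-net. There are about `s^(-2(N-1))` candidates, each of probability about
`s^(2M)`, which leaves `ρ^(-(M-N+1))` (`pi_measure_nearly_singular_le`). Entries larger than a small
power of `ρ` cost any desired power of `ρ`.

Lower bound. One small eigenvalue ruins all streams at once if its eigenvector has no small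
coordinate, and this is why the diversity does not depend on `R`. Near a matrix whose leading
columns are annihilated by the all-ones row, near-null vectors are spread out (`spread_of_close`).
Only the last `M - N + 1` entries of the last row then need to lie in discs of area `~ 1 / ρ`
(`le_outageProb_aux`). -/

namespace MIMO

/-! ### Unitary diagonalisation of the Gram matrix. -/

section LinearAlgebra

open scoped ComplexOrder

variable {N M : ℕ}

/-- The matrix `U diag(f) Uᴴ`. -/
def diagConj (U : Matrix (Fin N) (Fin N) ℂ) (f : Fin N → ℂ) : Matrix (Fin N) (Fin N) ℂ :=
  U * Matrix.diagonal f * Uᴴ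

lemma diagConj_mul {U : Matrix (Fin N) (Fin N) ℂ} (hU : Uᴴ * U = 1) (f g : Fin N → ℂ) :
    diagConj U f * diagConj U g = diagConj U (f * g) := by
  unfold diagConj
  calc U * Matrix.diagonal f * Uᴴ * (U * Matrix.diagonal g * Uᴴ)
      = U * Matrix.diagonal f * (Uᴴ * U) * Matrix.diagonal g * Uᴴ := by
        simp only [Matrix.mul_assoc]
    _ = U * Matrix.diagonal (f * g) * Uᴴ := by
        rw [hU, Matrix.mul_one, Matrix.mul_assoc U, Matrix.diagonal_mul_diagonal]; rfl

lemma diagConj_one {U : Matrix (Fin N) (Fin N) ℂ} (hU : U * Uᴴ = 1) : diagConj U 1 = 1 := by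
  simp [diagConj, hU]

lemma diagConj_add (U : Matrix (Fin N) (Fin N) ℂ) (f g : Fin N → ℂ) :
    diagConj U f + diagConj U g = diagConj U (f + g) := by
  simp only [diagConj, ← Matrix.add_mul, ← Matrix.mul_add, Matrix.diagonal_add]
  rfl

lemma diagConj_smul (U : Matrix (Fin N) (Fin N) ℂ) (a : ℂ) (f : Fin N → ℂ) :
    a • diagConj U f = diagConj U (a • f) := by
  simp [diagConj, Matrix.diagonal_smul]

lemma diagConj_conjTranspose (U : Matrix (Fin N) (Fin N) ℂ) (f : Fin N → ℂ) :
    (diagConj U f)ᴴ = diagConj U (star f) := by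
  simp [diagConj, Matrix.diagonal_conjTranspose, Matrix.mul_assoc]

lemma diagConj_inv {U : Matrix (Fin N) (Fin N) ℂ} (hU : Uᴴ * U = 1) {f : Fin N → ℂ}
    (hf : ∀ i, f i ≠ 0) : (diagConj U f)⁻¹ = diagConj U f⁻¹ := by
  apply Matrix.inv_eq_right_inv
  rw [diagConj_mul hU]
  have : f * f⁻¹ = 1 := by
    funext i; simp [hf i]
  rw [this, diagConj_one (mul_eq_one_comm.mp hU)]

lemma trace_diagConj {U : Matrix (Fin N) (Fin N) ℂ} (hU : Uᴴ * U = 1) (f : Fin N → ℂ) :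
    (diagConj U f).trace = ∑ i, f i := by
  rw [diagConj, Matrix.trace_mul_comm, ← Matrix.mul_assoc, hU, Matrix.one_mul,
    Matrix.trace_diagonal]

lemma sum_norm_sq_row (X : Matrix (Fin N) (Fin M) ℂ) (k : Fin N) :
    ((∑ j, ‖X k j‖ ^ 2 : ℝ) : ℂ) = (X * Xᴴ) k k := by
  rw [Matrix.mul_apply]
  push_cast
  refine Finset.sum_congr rfl fun j _ => ?_
  rw [Matrix.conjTranspose_apply, ← Complex.mul_conj']
  rfl

lemma diagConj_apply_diag (U : Matrix (Fin N) (Fin N) ℂ) (f : Fin N → ℂ) (k : Fin N) :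
    diagConj U f k k = ∑ i, (‖U k i‖ ^ 2 : ℂ) * f i := by
  rw [diagConj, Matrix.mul_apply]
  refine Finset.sum_congr rfl fun j _ => ?_
  rw [Matrix.mul_diagonal, Matrix.conjTranspose_apply, ← Complex.mul_conj']
  simp only [RCLike.star_def]; ring

lemma sum_norm_sq_diagConj_row {U : Matrix (Fin N) (Fin N) ℂ} (hU : Uᴴ * U = 1)
    (f : Fin N → ℂ) (k : Fin N) :
    ∑ j, ‖diagConj U f k j‖ ^ 2 = ∑ i, ‖U k i‖ ^ 2 * ‖f i‖ ^ 2 := by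
  have h := sum_norm_sq_row (diagConj U f) k
  rw [diagConj_conjTranspose, diagConj_mul hU, diagConj_apply_diag] at h
  have h2 : ∀ i, (f * star f) i = ((‖f i‖ ^ 2 : ℝ) : ℂ) := fun i => by
    simp [Complex.mul_conj']
  simp only [h2] at h
  exact_mod_cast h

lemma exists_diagConj_mul_conjTranspose (H : Matrix (Fin N) (Fin M) ℂ) :
    ∃ (U : Matrix (Fin N) (Fin N) ℂ) (l : Fin N → ℝ), Uᴴ * U = 1 ∧ (∀ i, 0 ≤ l i) ∧
      H * Hᴴ = diagConj U (fun i => (l i : ℂ)) := by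
  have hA := Matrix.posSemidef_self_mul_conjTranspose H
  refine ⟨hA.1.eigenvectorUnitary, hA.1.eigenvalues, ?_, hA.eigenvalues_nonneg, ?_⟩
  · exact Unitary.coe_star_mul_self hA.1.eigenvectorUnitary
  · exact hA.1.spectral_theorem

/-- The Gram matrix is diagonalised by `U`, so its eigenvalues are squared row norms. -/
lemma eigenvalue_eq_sum_norm_sq {H : Matrix (Fin N) (Fin M) ℂ} {U : Matrix (Fin N) (Fin N) ℂ}
    {l : Fin N → ℝ} (hU : Uᴴ * U = 1) (hH : H * Hᴴ = diagConj U (fun i => (l i : ℂ)))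
    (i : Fin N) : l i = ∑ j, ‖∑ k, star (U k i) * H k j‖ ^ 2 := by
  have h := sum_norm_sq_row (Uᴴ * H) i
  have h2 : Uᴴ * H * (Uᴴ * H)ᴴ = Matrix.diagonal (fun i => (l i : ℂ)) := by
    rw [Matrix.conjTranspose_mul, Matrix.conjTranspose_conjTranspose]
    calc Uᴴ * H * (Hᴴ * U) = Uᴴ * (H * Hᴴ) * U := by simp only [Matrix.mul_assoc]
      _ = (Uᴴ * U) * Matrix.diagonal (fun i => (l i : ℂ)) * (Uᴴ * U) := by
        rw [hH, diagConj]; simp only [Matrix.mul_assoc]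
      _ = _ := by rw [hU, Matrix.one_mul, Matrix.mul_one]
  rw [h2, Matrix.diagonal_apply_eq] at h
  have h3 := Complex.ofReal_injective h
  rw [← h3]
  simp [Matrix.mul_apply]

/-- Rayleigh quotient bound: with `a` the least eigenvalue, an almost-null row combination exhibits
a small eigenvalue. -/
lemma sum_norm_sq_vecMul_ge {H : Matrix (Fin N) (Fin M) ℂ} {U : Matrix (Fin N) (Fin N) ℂ}
    {l : Fin N → ℝ} (hU : Uᴴ * U = 1) (hH : H * Hᴴ = diagConj U (fun i => (l i : ℂ)))
    {a : ℝ} (hl : ∀ i, a ≤ l i) (w : Fin N → ℂ) :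
    a * ∑ k, ‖w k‖ ^ 2 ≤ ∑ j, ‖∑ k, w k * H k j‖ ^ 2 := by
  set X : Matrix (Fin 1) (Fin N) ℂ := Matrix.of fun _ => w with hX
  have h := sum_norm_sq_row (X * H) 0
  have e1 : X * H * (X * H)ᴴ = (X * U) * Matrix.diagonal (fun i => (l i : ℂ)) * (X * U)ᴴ := by
    rw [Matrix.conjTranspose_mul, Matrix.conjTranspose_mul]
    calc X * H * (Hᴴ * Xᴴ) = X * (H * Hᴴ) * Xᴴ := by simp only [Matrix.mul_assoc]
      _ = _ := by rw [hH, diagConj]; simp only [Matrix.mul_assoc]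
  have e2 : (X * U) * (X * U)ᴴ = X * Xᴴ := by
    rw [Matrix.conjTranspose_mul]
    calc X * U * (Uᴴ * Xᴴ) = X * (U * Uᴴ) * Xᴴ := by simp only [Matrix.mul_assoc]
      _ = _ := by rw [mul_eq_one_comm.mp hU, Matrix.mul_one]
  have h3 : ∑ k, ‖(X * U) 0 k‖ ^ 2 = ∑ k, ‖w k‖ ^ 2 := by
    have := sum_norm_sq_row (X * U) 0
    rw [e2, ← sum_norm_sq_row] at this
    have := Complex.ofReal_injective this
    rw [this]; rfl
  have h4 : ∑ j, ‖∑ k, w k * H k j‖ ^ 2 = ∑ k, ‖(X * U) 0 k‖ ^ 2 * l k := by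
    rw [e1, Matrix.mul_apply] at h
    have h5 : (∑ j, ((X * U) * Matrix.diagonal (fun i => (l i : ℂ))) 0 j * (X * U)ᴴ j 0)
        = ((∑ k, ‖(X * U) 0 k‖ ^ 2 * l k : ℝ) : ℂ) := by
      push_cast
      refine Finset.sum_congr rfl fun j _ => ?_
      rw [Matrix.mul_diagonal, Matrix.conjTranspose_apply, ← Complex.mul_conj']
      simp only [RCLike.star_def]; ring
    rw [h5] at h
    have := Complex.ofReal_injective h
    rw [← this]; rfl
  rw [h4, ← h3, Finset.mul_sum]
  refine Finset.sum_le_sum fun k _ => ?_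
  rw [mul_comm]
  exact mul_le_mul_of_nonneg_left (hl k) (by positivity)

lemma sum_norm_sq_row_unitary {U : Matrix (Fin N) (Fin N) ℂ} (hU : Uᴴ * U = 1) (k : Fin N) :
    ∑ i, ‖U k i‖ ^ 2 = 1 := by
  have h := sum_norm_sq_row U k
  rw [mul_eq_one_comm.mp hU, Matrix.one_apply_eq] at h
  exact_mod_cast h

lemma sum_norm_sq_col_unitary {U : Matrix (Fin N) (Fin N) ℂ} (hU : Uᴴ * U = 1) (i : Fin N) :
    ∑ k, ‖U k i‖ ^ 2 = 1 := by
  have h := sum_norm_sq_row Uᴴ i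
  rw [Matrix.conjTranspose_conjTranspose, hU, Matrix.one_apply_eq] at h
  simpa using Complex.ofReal_injective (h.trans Complex.ofReal_one.symm)

end LinearAlgebra

/-! ### Closed form of the SINR and two-sided estimates. -/

section Sinr

open scoped ComplexOrder

variable {N M : ℕ} {ρ : ℝ} {H : Matrix (Fin N) (Fin M) ℂ}

lemma isUnit_wienerF (hN : 1 ≤ N) (hρ : 0 < ρ) (H : Matrix (Fin N) (Fin M) ℂ) :
    IsUnit (wienerF ρ H).det := by
  have hc : (0 : ℝ) < N / ρ := by positivity
  have h1 : (((N : ℝ) / ρ : ℝ) • (1 : Matrix (Fin M) (Fin M) ℂ)).PosDef :=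
    Matrix.PosDef.one.smul hc
  have h2 : (wienerF ρ H).PosDef := by
    have := h1.posSemidef_add (Matrix.posSemidef_conjTranspose_mul_self H)
    unfold wienerF
    rw [Complex.coe_smul, add_comm]
    rwa [add_comm] at this
  exact isUnit_iff_ne_zero.mpr (Matrix.PosDef.det_pos h2).ne'

variable {U : Matrix (Fin N) (Fin N) ℂ} {l : Fin N → ℝ}

/-- Push-through identity `(Hᴴ H + c) Hᴴ = Hᴴ (H Hᴴ + c)`: the inverse moves to the `N × N` side,
where `U` diagonalises it. -/
lemma wienerF_inv_mul_conjTranspose (hN : 1 ≤ N) (hρ : 0 < ρ) (hU : Uᴴ * U = 1)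
    (hl : ∀ i, 0 ≤ l i) (hH : H * Hᴴ = diagConj U (fun i => (l i : ℂ))) :
    (wienerF ρ H)⁻¹ * Hᴴ = Hᴴ * diagConj U (fun i => ((l i + N / ρ : ℝ) : ℂ)⁻¹) := by
  have hF := isUnit_wienerF hN hρ H
  have hc : (0 : ℝ) < N / ρ := by positivity
  have hne : ∀ i, ((l i + N / ρ : ℝ) : ℂ) ≠ 0 := fun i =>
    Complex.ofReal_ne_zero.mpr (by have := hl i; positivity)
  have e : wienerF ρ H * Hᴴ = Hᴴ * diagConj U (fun i => ((l i + N / ρ : ℝ) : ℂ)) := by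
    have : diagConj U (fun i => ((l i + N / ρ : ℝ) : ℂ))
        = H * Hᴴ + (((N : ℝ) / ρ : ℝ) : ℂ) • (1 : Matrix (Fin N) (Fin N) ℂ) := by
      rw [hH, ← diagConj_one (mul_eq_one_comm.mp hU), diagConj_smul, diagConj_add]
      congr 1; funext i; simp
    rw [this, wienerF, Matrix.add_mul, Matrix.mul_add, Matrix.mul_assoc]
    simp
  have e2 : diagConj U (fun i => ((l i + N / ρ : ℝ) : ℂ))
      * diagConj U (fun i => ((l i + N / ρ : ℝ) : ℂ)⁻¹) = 1 := by
    rw [diagConj_mul hU, ← diagConj_one (mul_eq_one_comm.mp hU)]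
    congr 1; funext i
    exact mul_inv_cancel₀ (hne i)
  calc (wienerF ρ H)⁻¹ * Hᴴ
      = (wienerF ρ H)⁻¹ * (Hᴴ * diagConj U (fun i => ((l i + N / ρ : ℝ) : ℂ)))
          * diagConj U (fun i => ((l i + N / ρ : ℝ) : ℂ)⁻¹) := by
        rw [Matrix.mul_assoc, Matrix.mul_assoc Hᴴ, e2, Matrix.mul_one]
    _ = _ := by
        rw [← e, ← Matrix.mul_assoc, Matrix.nonsing_inv_mul _ hF, Matrix.one_mul]

lemma trace_wiener (hN : 1 ≤ N) (hρ : 0 < ρ) (hU : Uᴴ * U = 1)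
    (hl : ∀ i, 0 ≤ l i) (hH : H * Hᴴ = diagConj U (fun i => (l i : ℂ))) :
    (Matrix.trace ((wienerF ρ H)⁻¹ ^ 2 * (Hᴴ * H))).re = ∑ i, l i / (l i + N / ρ) ^ 2 := by
  have h1 := wienerF_inv_mul_conjTranspose hN hρ hU hl hH
  have hlc : ∀ i, 0 < l i + N / ρ := fun i => by have := hl i; positivity
  set D := diagConj U (fun i => ((l i + N / ρ : ℝ) : ℂ)⁻¹)
  have e : (wienerF ρ H)⁻¹ ^ 2 * (Hᴴ * H) = Hᴴ * (D * D * H) := by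
    calc (wienerF ρ H)⁻¹ ^ 2 * (Hᴴ * H)
        = (wienerF ρ H)⁻¹ * ((wienerF ρ H)⁻¹ * Hᴴ) * H := by
          rw [pow_two]; simp only [Matrix.mul_assoc]
      _ = ((wienerF ρ H)⁻¹ * Hᴴ) * D * H := by rw [h1, ← Matrix.mul_assoc, h1]
      _ = Hᴴ * (D * D * H) := by rw [h1]; simp only [Matrix.mul_assoc]
  rw [e, Matrix.trace_mul_comm, Matrix.mul_assoc, hH, diagConj_mul hU, diagConj_mul hU,
    trace_diagConj hU, Complex.re_sum]
  refine Finset.sum_congr rfl fun i _ => ?_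
  have : ((fun i => ((l i + N / ρ : ℝ) : ℂ)⁻¹) * (fun i => ((l i + N / ρ : ℝ) : ℂ)⁻¹)
      * fun i => (l i : ℂ)) i = ((l i / (l i + N / ρ) ^ 2 : ℝ) : ℂ) := by
    have h2 : l i / (l i + N / ρ) ^ 2 = (l i + N / ρ)⁻¹ * (l i + N / ρ)⁻¹ * l i := by
      have := (hlc i).ne'
      field_simp
    rw [h2, Complex.ofReal_mul, Complex.ofReal_mul, Complex.ofReal_inv]
    rfl
  rw [this, Complex.ofReal_re]

/-- The composite channel is square and invertible, so the equalizer is its inverse and only noise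
remains: the row norm of `U diag(g⁻¹) Uᴴ`, where `β⁻²` is the trace `τ`. -/
theorem sinrWienerZF_eq (hN : 1 ≤ N) (hρ : 0 < ρ) (hU : Uᴴ * U = 1)
    (hl : ∀ i, 0 < l i) (hH : H * Hᴴ = diagConj U (fun i => (l i : ℂ))) (k : Fin N) :
    sinrWienerZF ρ H k = (ρ / N) / ((∑ i, l i / (l i + N / ρ) ^ 2) *
      ∑ i, ‖U k i‖ ^ 2 * (1 + N / ρ / l i) ^ 2) := by
  have hl' : ∀ i, 0 ≤ l i := fun i => (hl i).le
  have hc : (0 : ℝ) < N / ρ := by positivity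
  have : Nonempty (Fin N) := ⟨⟨0, hN⟩⟩
  set τ := ∑ i, l i / (l i + N / ρ) ^ 2 with hτ
  have hτ0 : 0 < τ := Finset.sum_pos (fun i _ => by have := hl i; positivity) Finset.univ_nonempty
  have hβ : wienerBeta ρ H = Real.sqrt (1 / τ) := by
    rw [wienerBeta, trace_wiener hN hρ hU hl' hH]
  set β := wienerBeta ρ H with hβd
  have hβ0 : 0 < β := by rw [hβ]; positivity
  have hβ2 : β ^ 2 = 1 / τ := by rw [hβ, Real.sq_sqrt (by positivity)]
  have hlc : ∀ i, 0 < l i + N / ρ := fun i => by have := hl i; positivity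
  set g : Fin N → ℝ := fun i => β * (l i / (l i + N / ρ)) with hg
  have hg0 : ∀ i, 0 < g i := fun i => by have := hl i; have := hlc i; positivity
  have hG : H * wienerPrecoder ρ H = diagConj U (fun i => (g i : ℂ)) := by
    rw [wienerPrecoder, wienerF_inv_mul_conjTranspose hN hρ hU hl' hH, Matrix.mul_smul,
      ← Matrix.mul_assoc, hH, diagConj_mul hU, diagConj_smul]
    congr 1; funext i
    simp [hg, hβd, div_eq_mul_inv]
  have hgs : star (fun i => (g i : ℂ)) = fun i => (g i : ℂ) := by
    funext i; simp
  have hW : zfEqualizer (H * wienerPrecoder ρ H) = diagConj U (fun i => ((g i)⁻¹ : ℂ)) := by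
    rw [zfEqualizer, hG, diagConj_conjTranspose, hgs, diagConj_mul hU,
      diagConj_inv hU (fun i => by
        simpa using (hg0 i).ne'), diagConj_mul hU]
    congr 1; funext i
    have : (g i : ℂ) ≠ 0 := by exact_mod_cast (hg0 i).ne'
    simp only [Pi.mul_apply, Pi.inv_apply]
    field_simp
  have hWG : zfEqualizer (H * wienerPrecoder ρ H) * H * wienerPrecoder ρ H = 1 := by
    rw [Matrix.mul_assoc, hW, hG, diagConj_mul hU, ← diagConj_one (mul_eq_one_comm.mp hU)]
    congr 1; funext i
    have : (g i : ℂ) ≠ 0 := by exact_mod_cast (hg0 i).ne'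
    simp [this]
  rw [sinrWienerZF, sinr, hWG, hW, sum_norm_sq_diagConj_row hU]
  have h0 : ∑ i ∈ Finset.univ.erase k, ‖(1 : Matrix (Fin N) (Fin N) ℂ) k i‖ ^ 2 = 0 :=
    Finset.sum_eq_zero fun i hi => by
      rw [Matrix.one_apply_ne (Finset.ne_of_mem_erase hi).symm]; simp
  rw [h0, Matrix.one_apply_eq]
  have h1 : ∑ i, ‖U k i‖ ^ 2 * ‖((g i : ℂ))⁻¹‖ ^ 2
      = τ * ∑ i, ‖U k i‖ ^ 2 * (1 + N / ρ / l i) ^ 2 := by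
    rw [Finset.mul_sum]
    refine Finset.sum_congr rfl fun i _ => ?_
    have e : (g i)⁻¹ = β⁻¹ * (1 + N / ρ / l i) := by
      have := (hl i).ne'
      have := (hlc i).ne'
      simp only [hg]
      rw [one_add_div (hl i).ne', mul_inv, inv_div]
    have e2 : ‖((g i : ℂ))⁻¹‖ ^ 2 = τ * (1 + N / ρ / l i) ^ 2 := by
      rw [← Complex.ofReal_inv, Complex.norm_real, Real.norm_eq_abs, sq_abs, e, mul_pow, inv_pow,
        hβ2, one_div, inv_inv]
    rw [e2]; ring
  rw [h1]; simp

lemma sinr_nonneg {B : ℕ} (hρ : 0 < ρ) (H : Matrix (Fin N) (Fin M) ℂ)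
    (T : Matrix (Fin M) (Fin B) ℂ) (W : Matrix (Fin B) (Fin N) ℂ) (k : Fin B) :
    0 ≤ sinr ρ H T W k := by
  unfold sinr; positivity

/-- The inverse of a singular matrix is `0` by convention, so the equalizer is `0` and the SINR is
`0 / 0 = 0`. Degenerate channels thus need no almost-sure argument. -/
lemma sinrWienerZF_eq_zero (hN : 1 ≤ N) (hρ : 0 < ρ) (hdet : (H * Hᴴ).det = 0) (k : Fin N) :
    sinrWienerZF ρ H k = 0 := by
  obtain ⟨U, l, hU, hl, hH⟩ := exists_diagConj_mul_conjTranspose H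
  have hG : (H * wienerPrecoder ρ H).det = 0 := by
    rw [wienerPrecoder, wienerF_inv_mul_conjTranspose hN hρ hU hl hH, Matrix.mul_smul,
      ← Matrix.mul_assoc, Matrix.det_smul, Matrix.det_mul, hdet]
    simp
  have hW : zfEqualizer (H * wienerPrecoder ρ H) = 0 := by
    rw [zfEqualizer, Matrix.nonsing_inv_apply_not_isUnit _ (by
      rw [Matrix.det_mul, hG, mul_zero]; exact not_isUnit_zero), Matrix.zero_mul]
  rw [sinrWienerZF, sinr, hW]
  simp

/-- If all squared singular values exceed `t N / ρ`, every SINR is at least `t / (4 N)`. -/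
theorem le_sinrWienerZF (hN : 1 ≤ N) (hρ : 0 < ρ) (hU : Uᴴ * U = 1)
    (hH : H * Hᴴ = diagConj U (fun i => (l i : ℂ))) {t : ℝ} (ht : 1 ≤ t)
    (hl : ∀ i, t * (N / ρ) ≤ l i) (k : Fin N) : t / (4 * N) ≤ sinrWienerZF ρ H k := by
  have hc : (0 : ℝ) < N / ρ := by positivity
  have hl0 : ∀ i, 0 < l i := fun i => lt_of_lt_of_le (by positivity) (hl i)
  have : Nonempty (Fin N) := ⟨⟨0, hN⟩⟩
  rw [sinrWienerZF_eq hN hρ hU hl0 hH]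
  have hτ0 : 0 < ∑ i, l i / (l i + N / ρ) ^ 2 :=
    Finset.sum_pos (fun i _ => by have := hl0 i; positivity) Finset.univ_nonempty
  have hτ : ∑ i, l i / (l i + N / ρ) ^ 2 ≤ N * (1 / (t * (N / ρ))) := by
    calc ∑ i, l i / (l i + N / ρ) ^ 2 ≤ ∑ _i : Fin N, 1 / (t * (N / ρ)) := by
          refine Finset.sum_le_sum fun i _ => ?_
          have := hl0 i
          calc l i / (l i + N / ρ) ^ 2 ≤ l i / (l i) ^ 2 := by gcongr; linarith
            _ = 1 / l i := by field_simp
            _ ≤ _ := one_div_le_one_div_of_le (by positivity) (hl i)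
      _ = _ := by simp
  have hS : ∑ i, ‖U k i‖ ^ 2 * (1 + N / ρ / l i) ^ 2 ≤ 4 := by
    calc ∑ i, ‖U k i‖ ^ 2 * (1 + N / ρ / l i) ^ 2 ≤ ∑ i, ‖U k i‖ ^ 2 * 4 := by
          refine Finset.sum_le_sum fun i _ => ?_
          have := hl0 i
          have h1 : N / ρ / l i ≤ 1 := by
            rw [div_le_one this]
            nlinarith [hl i]
          have h2 : 0 ≤ N / ρ / l i := by positivity
          have : (1 + N / ρ / l i) ^ 2 ≤ 4 := by nlinarith
          gcongr
      _ = 4 := by rw [← Finset.sum_mul, sum_norm_sq_row_unitary hU]; norm_num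
  have hS0 : 0 < ∑ i, ‖U k i‖ ^ 2 * (1 + N / ρ / l i) ^ 2 := by
    calc (0 : ℝ) < ∑ i, ‖U k i‖ ^ 2 := by rw [sum_norm_sq_row_unitary hU]; norm_num
      _ ≤ _ := by
        refine Finset.sum_le_sum fun i _ => ?_
        have := hl0 i
        have h2 : 0 ≤ N / ρ / l i := by positivity
        have : 1 ≤ (1 + N / ρ / l i) ^ 2 := by nlinarith
        exact le_mul_of_one_le_right (by positivity) this
  have hNpos : (0 : ℝ) < N := by exact_mod_cast hN
  calc t / (4 * N) = (ρ / N) / ((N * (1 / (t * (N / ρ)))) * 4) := by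
        field_simp
    _ ≤ _ := by gcongr

/-- If some squared singular value is at most `t N / ρ` and its singular vector is spread out over
the coordinates, every SINR is at most `4 N t`. -/
theorem sinrWienerZF_le (hN : 1 ≤ N) (hρ : 0 < ρ) (hU : Uᴴ * U = 1)
    (hl0 : ∀ i, 0 ≤ l i) (hH : H * Hᴴ = diagConj U (fun i => (l i : ℂ))) {t : ℝ} {i : Fin N}
    (hl : l i ≤ t * (N / ρ)) (k : Fin N) (hk : 1 / (4 * N) ≤ ‖U k i‖ ^ 2) :
    sinrWienerZF ρ H k ≤ 4 * N * t := by
  have hc : (0 : ℝ) < N / ρ := by positivity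
  have ht : 0 ≤ t := by
    by_contra h
    push Not at h
    nlinarith [hl0 i, mul_pos_of_neg_of_neg h (neg_neg_of_pos hc)]
  by_cases hpos : ∀ i, 0 < l i
  · rw [sinrWienerZF_eq hN hρ hU hpos hH]
    have hNpos : (0 : ℝ) < N := by exact_mod_cast hN
    have hi := hpos i
    have h1 : l i / (l i + N / ρ) ^ 2 ≤ ∑ i, l i / (l i + N / ρ) ^ 2 :=
      Finset.single_le_sum (f := fun i => l i / (l i + N / ρ) ^ 2)
        (fun i _ => by have := hpos i; positivity) (Finset.mem_univ i)
    have h2 : ‖U k i‖ ^ 2 * (1 + N / ρ / l i) ^ 2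
        ≤ ∑ i, ‖U k i‖ ^ 2 * (1 + N / ρ / l i) ^ 2 :=
      Finset.single_le_sum (f := fun i => ‖U k i‖ ^ 2 * (1 + N / ρ / l i) ^ 2)
        (fun i _ => by positivity) (Finset.mem_univ i)
    -- Keeping only the `i`-th term of each sum, the factors `(l i + N / ρ)²` cancel.
    have h3 : 1 / (4 * N * l i) ≤ (∑ i, l i / (l i + N / ρ) ^ 2) *
        ∑ i, ‖U k i‖ ^ 2 * (1 + N / ρ / l i) ^ 2 := by
      calc 1 / (4 * N * l i)
          = l i / (l i + N / ρ) ^ 2 * (1 / (4 * N) * (1 + N / ρ / l i) ^ 2) := by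
            rw [one_add_div hi.ne']
            have : l i + N / ρ ≠ 0 := by positivity
            field_simp
        _ ≤ l i / (l i + N / ρ) ^ 2 * (‖U k i‖ ^ 2 * (1 + N / ρ / l i) ^ 2) := by gcongr
        _ ≤ _ := by
            refine mul_le_mul h1 h2 (by positivity) (le_trans ?_ h1)
            positivity
    calc _ ≤ (ρ / N) / (1 / (4 * N * l i)) := by gcongr
      _ = 4 * N * (l i / (N / ρ)) := by field_simp
      _ ≤ 4 * N * t := by
        gcongr
        rwa [div_le_iff₀ hc]
  · push Not at hpos
    obtain ⟨j, hj⟩ := hpos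
    have hj0 : l j = 0 := le_antisymm hj (hl0 j)
    rw [sinrWienerZF_eq_zero hN hρ]
    · positivity
    · rw [hH, diagConj, Matrix.det_mul, Matrix.det_mul, Matrix.det_diagonal,
        Finset.prod_eq_zero (Finset.mem_univ j) (by simp [hj0])]
      simp

end Sinr

/-! ### Disc probabilities and tails of the complex Gaussian. -/

section Gaussian

open scoped ENNReal

instance : IsProbabilityMeasure stdComplexGaussian := by
  unfold stdComplexGaussian
  exact Measure.isProbabilityMeasure_map Complex.measurableEquivRealProd.symm.measurable.aemeasurable

lemma gaussianPDFReal_half (x : ℝ) :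
    gaussianPDFReal 0 (1 / 2 : ℝ≥0) x = (√Real.pi)⁻¹ * Real.exp (-x ^ 2) := by
  have h : 2 * Real.pi * ((1 / 2 : ℝ≥0) : ℝ) = Real.pi := by push_cast; ring
  rw [gaussianPDFReal, h]
  congr 2
  push_cast; ring

lemma gaussianReal_half_le_volume (s : Set ℝ) :
    gaussianReal 0 (1 / 2 : ℝ≥0) s ≤ volume s := by
  rw [gaussianReal_apply 0 (by norm_num)]
  calc ∫⁻ x in s, gaussianPDF 0 (1 / 2) x ≤ ∫⁻ _x in s, 1 := by
        refine lintegral_mono fun x => ?_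
        rw [gaussianPDF, gaussianPDFReal_half]
        refine ENNReal.ofReal_le_one.mpr ?_
        have h1 : (1 : ℝ) ≤ √Real.pi := Real.one_le_sqrt.mpr (by linarith [Real.pi_gt_three])
        exact mul_le_one₀ (inv_le_one_of_one_le₀ h1) (Real.exp_pos _).le
          (Real.exp_le_one_iff.mpr (by nlinarith))
    _ = volume s := by simp

lemma volume_le_gaussianReal_half {s : Set ℝ} (hs : MeasurableSet s) {b : ℝ}
    (hb : ∀ x ∈ s, |x| ≤ b) :
    ENNReal.ofReal ((√Real.pi)⁻¹ * Real.exp (-b ^ 2)) * volume s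
      ≤ gaussianReal 0 (1 / 2 : ℝ≥0) s := by
  rw [gaussianReal_apply 0 (by norm_num), ← setLIntegral_const]
  refine setLIntegral_mono' hs fun x hx => ?_
  rw [gaussianPDF, gaussianPDFReal_half]
  have : x ^ 2 ≤ b ^ 2 := sq_le_sq' (by linarith [neg_abs_le x, hb x hx])
    ((le_abs_self x).trans (hb x hx))
  gcongr

lemma stdComplexGaussian_apply (s : Set ℂ) :
    stdComplexGaussian s = ((gaussianReal 0 (1 / 2 : ℝ≥0)).prod (gaussianReal 0 (1 / 2 : ℝ≥0)))
      {p | (⟨p.1, p.2⟩ : ℂ) ∈ s} := by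
  rw [stdComplexGaussian, MeasurableEquiv.map_apply]
  rfl

/-- The disc lies in a square of side `2 r` and each coordinate has density at most `1`. Uniformity
in the centre is what slicing requires. -/
lemma stdComplexGaussian_closedBall_le (a : ℂ) {r : ℝ} (hr : 0 ≤ r) :
    stdComplexGaussian (Metric.closedBall a r) ≤ ENNReal.ofReal (4 * r ^ 2) := by
  rw [stdComplexGaussian_apply]
  have hsub : {p : ℝ × ℝ | (⟨p.1, p.2⟩ : ℂ) ∈ Metric.closedBall a r}
      ⊆ Set.Icc (a.re - r) (a.re + r) ×ˢ Set.Icc (a.im - r) (a.im + r) := by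
    rintro ⟨x, y⟩ h
    simp only [Set.mem_ofPred_eq, Metric.mem_closedBall, dist_eq_norm] at h
    have h1 := abs_le.mp ((Complex.abs_re_le_norm _).trans h)
    have h2 := abs_le.mp ((Complex.abs_im_le_norm _).trans h)
    simp only [Complex.sub_re, Complex.sub_im] at h1 h2
    simp only [Set.mem_prod, Set.mem_Icc]
    refine ⟨⟨?_, ?_⟩, ?_, ?_⟩ <;> linarith
  refine (measure_mono hsub).trans ?_
  rw [Measure.prod_prod]
  refine (mul_le_mul' (gaussianReal_half_le_volume _) (gaussianReal_half_le_volume _)).trans ?_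
  rw [Real.volume_Icc, Real.volume_Icc, ← ENNReal.ofReal_mul (by linarith)]
  apply le_of_eq; congr 1; ring

lemma exists_le_stdComplexGaussian_closedBall :
    ∃ c : ℝ, 0 < c ∧ ∀ (a : ℂ) (r : ℝ), ‖a‖ ≤ 1 → 0 ≤ r → r ≤ 1 →
      ENNReal.ofReal (c * r ^ 2) ≤ stdComplexGaussian (Metric.closedBall a r) := by
  -- The density at `2`: the inscribed square of side `r ≤ 1` around `a` has coordinates of modulus
  -- at most `3 / 2`.
  set b := (√Real.pi)⁻¹ * Real.exp (-2 ^ 2) with hb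
  have hb0 : 0 < b := by have := Real.pi_pos; positivity
  refine ⟨b ^ 2, by positivity, fun a r ha hr hr1 => ?_⟩
  rw [stdComplexGaussian_apply]
  have hsub : Set.Icc (a.re - r / 2) (a.re + r / 2) ×ˢ Set.Icc (a.im - r / 2) (a.im + r / 2)
      ⊆ {p : ℝ × ℝ | (⟨p.1, p.2⟩ : ℂ) ∈ Metric.closedBall a r} := by
    rintro ⟨x, y⟩ ⟨h1, h2⟩
    simp only [Set.mem_Icc] at h1 h2
    simp only [Set.mem_ofPred_eq, Metric.mem_closedBall, dist_eq_norm]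
    refine (Complex.norm_le_abs_re_add_abs_im _).trans ?_
    have h3 : |x - a.re| ≤ r / 2 := abs_le.mpr ⟨by linarith, by linarith⟩
    have h4 : |y - a.im| ≤ r / 2 := abs_le.mpr ⟨by linarith, by linarith⟩
    simp only [Complex.sub_re, Complex.sub_im]
    linarith
  refine le_trans ?_ (measure_mono hsub)
  rw [Measure.prod_prod]
  have key : ∀ x : ℝ, |x| ≤ 1 → ENNReal.ofReal (b * r)
      ≤ gaussianReal 0 (1 / 2 : ℝ≥0) (Set.Icc (x - r / 2) (x + r / 2)) := by
    intro x hx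
    refine le_trans ?_ (volume_le_gaussianReal_half measurableSet_Icc (b := 2) ?_)
    · rw [Real.volume_Icc, ← ENNReal.ofReal_mul hb0.le]
      apply le_of_eq; congr 1; rw [hb]; ring
    · rintro y ⟨h1, h2⟩
      have := abs_le.mp hx
      exact abs_le.mpr ⟨by linarith, by linarith⟩
  refine le_trans ?_ (mul_le_mul' (key a.re ((Complex.abs_re_le_norm a).trans ha))
    (key a.im ((Complex.abs_im_le_norm a).trans ha)))
  rw [← ENNReal.ofReal_mul (by positivity)]
  apply le_of_eq; congr 1; ring

/-- Markov's inequality for the `p`-th moment. Polynomial decay of every order suffices, since `K`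
will be a small power of `ρ`. -/
lemma exists_gaussianReal_half_tail (p : ℕ) :
    ∃ C : ℝ, 0 < C ∧ ∀ K : ℝ, 0 < K →
      gaussianReal 0 (1 / 2 : ℝ≥0) {x | K ≤ |x|} ≤ ENNReal.ofReal (C / K ^ p) := by
  have hm : MemLp id ((p : ℝ≥0∞) + 1) (gaussianReal 0 (1 / 2 : ℝ≥0)) :=
    memLp_id_gaussianReal' _ (by simp)
  have hint : Integrable (fun x : ℝ => |x| ^ p) (gaussianReal 0 (1 / 2 : ℝ≥0)) := by
    have := (hm.mono_exponent (p := (p : ℝ≥0∞)) le_self_add)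
    simpa using this.integrable_norm_pow'
  refine ⟨∫ x, |x| ^ p ∂(gaussianReal 0 (1 / 2 : ℝ≥0)) + 1, ?_, fun K hK => ?_⟩
  · have : 0 ≤ ∫ x, |x| ^ p ∂(gaussianReal 0 (1 / 2 : ℝ≥0)) :=
      integral_nonneg fun x => by positivity
    linarith
  have h := mul_meas_ge_le_integral_of_nonneg (ae_of_all _ fun x : ℝ => by positivity) hint (K ^ p)
  have hsub : {x : ℝ | K ≤ |x|} ⊆ {x | K ^ p ≤ |x| ^ p} := fun x hx =>
    pow_le_pow_left₀ hK.le hx p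
  refine (measure_mono hsub).trans ?_
  rw [← ofReal_measureReal]
  refine ENNReal.ofReal_le_ofReal ?_
  rw [le_div_iff₀ (by positivity)]
  linarith

lemma exists_stdComplexGaussian_tail (p : ℕ) :
    ∃ C : ℝ, 0 < C ∧ ∀ K : ℝ, 0 < K →
      stdComplexGaussian {z | K < ‖z‖} ≤ ENNReal.ofReal (C / K ^ p) := by
  obtain ⟨C, hC, h⟩ := exists_gaussianReal_half_tail p
  refine ⟨2 * (C * 2 ^ p), by positivity, fun K hK => ?_⟩
  rw [stdComplexGaussian_apply]
  have hsub : {q : ℝ × ℝ | (⟨q.1, q.2⟩ : ℂ) ∈ {z : ℂ | K < ‖z‖}}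
      ⊆ {x : ℝ | K / 2 ≤ |x|} ×ˢ Set.univ ∪ Set.univ ×ˢ {x : ℝ | K / 2 ≤ |x|} := by
    rintro ⟨x, y⟩ hxy
    simp only [Set.mem_ofPred_eq] at hxy
    have := hxy.trans_le (Complex.norm_le_abs_re_add_abs_im _)
    simp only at this
    by_contra hcon
    simp only [Set.mem_union, Set.mem_prod, Set.mem_ofPred_eq, Set.mem_univ, and_true, true_and,
      not_or, not_le] at hcon
    linarith
  refine (measure_mono hsub).trans ((measure_union_le _ _).trans ?_)
  rw [Measure.prod_prod, Measure.prod_prod, measure_univ, mul_one, one_mul]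
  refine (add_le_add (h _ (by positivity)) (h _ (by positivity))).trans ?_
  rw [← ENNReal.ofReal_add (by positivity) (by positivity)]
  apply le_of_eq; congr 1
  rw [div_pow]; field_simp; ring

end Gaussian

/-! ### Fubini for discs with centres depending on the other coordinates. -/

section Slicing

open scoped ENNReal

variable {ι : Type*} [Fintype ι] (q : ι → Prop) [DecidablePred q]
  (μ : Measure ℂ) [IsProbabilityMeasure μ]

/-- Disintegration of a product measure over the coordinates selected by `q`: the selected
coordinates lie in discs whose centres depend on the remaining coordinates. -/
lemma pi_measure_discs_eq_lintegral {φ : ({i // ¬ q i} → ℂ) → {i // q i} → ℂ} (hφ : Measurable φ)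
    {V : Set ({i // ¬ q i} → ℂ)} (hV : MeasurableSet V) (r : ℝ) :
    Measure.pi (fun _ : ι => μ) {x | (fun i : {i // ¬ q i} => x i) ∈ V ∧
        ∀ i : {i // q i}, x i ∈ Metric.closedBall (φ (fun i : {i // ¬ q i} => x i) i) r}
      = ∫⁻ y in V, ∏ i, μ (Metric.closedBall (φ y i) r)
          ∂(Measure.pi fun _ : {i // ¬ q i} => μ) := by
  have hmp := measurePreserving_piEquivPiSubtypeProd (fun _ : ι => μ) q
  set S : Set (({i // q i} → ℂ) × ({i // ¬ q i} → ℂ)) :=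
    {z | z.2 ∈ V ∧ ∀ i, z.1 i ∈ Metric.closedBall (φ z.2 i) r} with hS
  have hSm : MeasurableSet S := by
    have hi : S = Prod.snd ⁻¹' V ∩ ⋂ i, {z : ({i // q i} → ℂ) × ({i // ¬ q i} → ℂ) |
        dist (z.1 i) (φ z.2 i) ≤ r} := by
      ext z; simp [hS]
    rw [hi]
    refine MeasurableSet.inter (measurable_snd hV) (MeasurableSet.iInter fun i => ?_)
    refine measurableSet_le (Measurable.dist ?_ ?_) measurable_const
    · exact (measurable_pi_apply i).comp measurable_fst
    · exact (measurable_pi_apply i).comp (hφ.comp measurable_snd)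
  have h1 := hmp.measure_preimage hSm.nullMeasurableSet
  have h2 : (MeasurableEquiv.piEquivPiSubtypeProd (fun _ : ι => ℂ) q) ⁻¹' S
      = {x | (fun i : {i // ¬ q i} => x i) ∈ V ∧
        ∀ i : {i // q i}, x i ∈ Metric.closedBall (φ (fun i : {i // ¬ q i} => x i) i) r} := rfl
  rw [← h2, h1, Measure.prod_apply_symm hSm, ← lintegral_indicator hV]
  refine lintegral_congr fun y => ?_
  by_cases hy : y ∈ V
  · rw [Set.indicator_of_mem hy]
    have : (fun x => (x, y)) ⁻¹' S = Set.univ.pi fun i => Metric.closedBall (φ y i) r := by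
      ext x; simp [hS, hy]
    rw [this, Measure.pi_pi]
  · rw [Set.indicator_of_notMem hy]
    have : (fun x => (x, y)) ⁻¹' S = ∅ := by
      ext x; simp [hS, hy]
    rw [this, measure_empty]

lemma pi_measure_discs_le {φ : ({i // ¬ q i} → ℂ) → {i // q i} → ℂ} (hφ : Measurable φ)
    {r : ℝ} {b : ℝ≥0∞} (hb : ∀ a, μ (Metric.closedBall a r) ≤ b) :
    Measure.pi (fun _ : ι => μ) {x | ∀ i : {i // q i},
        x i ∈ Metric.closedBall (φ (fun i : {i // ¬ q i} => x i) i) r}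
      ≤ b ^ Fintype.card {i // q i} := by
  have h := pi_measure_discs_eq_lintegral q μ hφ MeasurableSet.univ r
  simp only [Set.mem_univ, true_and] at h
  rw [h]
  calc _ ≤ ∫⁻ _y in Set.univ, b ^ Fintype.card {i // q i}
          ∂(Measure.pi fun _ : {i // ¬ q i} => μ) := by
        refine lintegral_mono fun y => ?_
        rw [← Finset.card_univ]
        exact Finset.prod_le_pow_card _ _ _ fun i _ => hb _
    _ = _ := by simp

/-- The restriction to `V` is needed because discs have a uniform lower bound only for centres in a
bounded region. -/
lemma le_pi_measure_discs {φ : ({i // ¬ q i} → ℂ) → {i // q i} → ℂ} (hφ : Measurable φ)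
    {V : Set ({i // ¬ q i} → ℂ)} (hV : MeasurableSet V) {r : ℝ} {b : ℝ≥0∞}
    (hb : ∀ y ∈ V, ∀ i, b ≤ μ (Metric.closedBall (φ y i) r)) :
    b ^ Fintype.card {i // q i} * Measure.pi (fun _ : {i // ¬ q i} => μ) V
      ≤ Measure.pi (fun _ : ι => μ) {x | (fun i : {i // ¬ q i} => x i) ∈ V ∧
        ∀ i : {i // q i}, x i ∈ Metric.closedBall (φ (fun i : {i // ¬ q i} => x i) i) r} := by
  rw [pi_measure_discs_eq_lintegral q μ hφ hV r, ← setLIntegral_const]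
  refine setLIntegral_mono' hV fun y hy => ?_
  rw [← Finset.card_univ]
  exact Finset.pow_card_le_prod _ _ _ fun i _ => hb y hy i

end Slicing

/-! ### Transfer from the channel to the product measure. -/

section Channel

variable {Ω : Type*} [MeasurableSpace Ω] {P : Measure Ω} {N M : ℕ}
  {H : Ω → Matrix (Fin N) (Fin M) ℂ}

lemma IsGaussianChannel.aemeasurable (hH : IsGaussianChannel H P) :
    AEMeasurable (fun ω (p : Fin N × Fin M) => H ω p.1 p.2) P :=
  aemeasurable_pi_lambda _ fun p => (hH.law p.1 p.2).aemeasurable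

lemma IsGaussianChannel.map_eq [IsProbabilityMeasure P] (hH : IsGaussianChannel H P) :
    P.map (fun ω (p : Fin N × Fin M) => H ω p.1 p.2)
      = Measure.pi fun _ => stdComplexGaussian := by
  rw [(iIndepFun_iff_map_fun_eq_pi_map
    (fun p : Fin N × Fin M => (hH.law p.1 p.2).aemeasurable)).mp hH.indep]
  congr 1; funext p
  exact (hH.law p.1 p.2).map_eq

/-- Valid for arbitrary sets, so the near-singular set need not be shown measurable. -/
lemma IsGaussianChannel.measure_le [IsProbabilityMeasure P] (hH : IsGaussianChannel H P)
    (S : Set (Fin N × Fin M → ℂ)) :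
    P {ω | (fun p : Fin N × Fin M => H ω p.1 p.2) ∈ S}
      ≤ Measure.pi (fun _ => stdComplexGaussian) S := by
  rw [← hH.map_eq]
  exact Measure.le_map_apply hH.aemeasurable S

lemma IsGaussianChannel.measure_eq [IsProbabilityMeasure P] (hH : IsGaussianChannel H P)
    {S : Set (Fin N × Fin M → ℂ)} (hS : MeasurableSet S) :
    P {ω | (fun p : Fin N × Fin M => H ω p.1 p.2) ∈ S}
      = Measure.pi (fun _ => stdComplexGaussian) S := by
  rw [← hH.map_eq, Measure.map_apply_of_aemeasurable hH.aemeasurable hS]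
  rfl

end Channel

/-! ### Outage in terms of almost-null row combinations. -/

section OutageCriteria

variable {N M : ℕ} {ρ R : ℝ} {H : Matrix (Fin N) (Fin M) ℂ}

theorem exists_unit_of_outage (hN : 1 ≤ N) (hρ : 0 < ρ) (hR : 0 < R)
    (hout : ∑ k, Real.logb 2 (1 + sinrWienerZF ρ H k) ≤ R) :
    ∃ u : Fin N → ℂ, ∑ k, ‖u k‖ ^ 2 = 1 ∧
      ∑ j, ‖∑ k, u k * H k j‖ ^ 2 ≤ 4 * N * 2 ^ R * (N / ρ) := by
  obtain ⟨U, l, hU, hl, hH⟩ := exists_diagConj_mul_conjTranspose H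
  have hN1 : (1 : ℝ) ≤ N := by exact_mod_cast hN
  have h2R : (1 : ℝ) ≤ 2 ^ R := Real.one_le_rpow (by norm_num) hR.le
  by_cases h : ∃ i, l i ≤ 4 * N * 2 ^ R * (N / ρ)
  · obtain ⟨i, hi⟩ := h
    refine ⟨fun k => star (U k i), ?_, ?_⟩
    · simpa using sum_norm_sq_col_unitary hU i
    · rwa [← eigenvalue_eq_sum_norm_sq hU hH i]
  · exfalso
    push Not at h
    -- With this `t` the SINR bound `t / (4 N)` equals `2 ^ R`, so a single stream already carries
    -- more than `R`.
    have hs := fun k => le_sinrWienerZF hN hρ hU hH (t := 4 * N * 2 ^ R)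
      (by nlinarith) (fun i => (h i).le) k
    have hs' : ∀ k, R < Real.logb 2 (1 + sinrWienerZF ρ H k) := fun k => by
      have h3 : (2 : ℝ) ^ R < 1 + sinrWienerZF ρ H k := by
        have := hs k
        rw [mul_div_cancel_left₀ _ (by positivity)] at this
        linarith
      exact (Real.lt_logb_iff_rpow_lt (by norm_num) (by linarith)).mpr h3
    have : R < ∑ k, Real.logb 2 (1 + sinrWienerZF ρ H k) :=
      (hs' ⟨0, hN⟩).trans_le (Finset.single_le_sum
        (f := fun k => Real.logb 2 (1 + sinrWienerZF ρ H k))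
        (fun k _ => (hR.trans (hs' k)).le) (Finset.mem_univ _))
    linarith

/-- The vector `w` forces a small eigenvalue, and `hspread` applies to its conjugated eigenvector.
The bound on `t` makes `1 + 4 N t ≤ 2 ^ (R / N)`, so each stream carries at most `R / N`. -/
theorem outage_of_spread (hN : 1 ≤ N) (hρ : 0 < ρ) {t : ℝ}
    (ht : t ≤ (2 ^ (R / N) - 1) / (4 * N)) {w : Fin N → ℂ} (hw0 : w ≠ 0)
    (hw : ∑ j, ‖∑ k, w k * H k j‖ ^ 2 ≤ t * (N / ρ) * ∑ k, ‖w k‖ ^ 2)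
    (hspread : ∀ u : Fin N → ℂ, ∑ k, ‖u k‖ ^ 2 = 1 →
      ∑ j, ‖∑ k, u k * H k j‖ ^ 2 ≤ t * (N / ρ) → ∀ k, 1 / (4 * N) ≤ ‖u k‖ ^ 2) :
    ∑ k, Real.logb 2 (1 + sinrWienerZF ρ H k) ≤ R := by
  obtain ⟨U, l, hU, hl, hH⟩ := exists_diagConj_mul_conjTranspose H
  have hN1 : (0 : ℝ) < N := by exact_mod_cast hN
  have : Nonempty (Fin N) := ⟨⟨0, hN⟩⟩
  have hwpos : 0 < ∑ k, ‖w k‖ ^ 2 := by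
    obtain ⟨k, hk⟩ := Function.ne_iff.mp hw0
    exact Finset.sum_pos' (fun _ _ => by positivity)
      ⟨k, Finset.mem_univ _, by have := norm_pos_iff.mpr hk; positivity⟩
  obtain ⟨i, hi⟩ : ∃ i, l i ≤ t * (N / ρ) := by
    obtain ⟨i, hi⟩ := Finite.exists_min l
    refine ⟨i, ?_⟩
    have := (sum_norm_sq_vecMul_ge hU hH hi w).trans hw
    exact le_of_mul_le_mul_right this hwpos
  have hsp : ∀ k, 1 / (4 * N) ≤ ‖U k i‖ ^ 2 := fun k => by
    have := hspread (fun k => star (U k i)) (by simpa using sum_norm_sq_col_unitary hU i)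
      (by rwa [← eigenvalue_eq_sum_norm_sq hU hH i]) k
    simpa using this
  have hk : ∀ k, Real.logb 2 (1 + sinrWienerZF ρ H k) ≤ R / N := fun k => by
    have h1 := sinrWienerZF_le hN hρ hU hl hH hi k (hsp k)
    have h0 : 0 ≤ sinrWienerZF ρ H k := sinr_nonneg hρ _ _ _ _
    rw [Real.logb_le_iff_le_rpow (by norm_num) (by linarith)]
    have h2 : 4 * N * t ≤ 2 ^ (R / N) - 1 := by
      rw [le_div_iff₀ (by positivity)] at ht
      linarith
    linarith
  calc _ ≤ ∑ _k : Fin N, R / N := Finset.sum_le_sum fun k _ => hk k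
    _ = R := by simp; field_simp

end OutageCriteria

/-! ### Net argument for nearly singular matrices. -/

section Covering

lemma exists_net_unitDisc {n : ℕ} (hn : 0 < n) :
    ∃ T : Finset ℂ, T.card ≤ (2 * n + 1) ^ 2 ∧
      ∀ z : ℂ, ‖z‖ ≤ 1 → ∃ t ∈ T, ‖t - z‖ ≤ 1 / n := by
  have hn' : (0 : ℝ) < n := by exact_mod_cast hn
  let g : ℤ × ℤ → ℂ := fun p => ⟨p.1 / n, p.2 / n⟩
  refine ⟨(Finset.Icc (-(n : ℤ)) n ×ˢ Finset.Icc (-(n : ℤ)) n).image g, ?_, fun z hz => ?_⟩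
  · refine Finset.card_image_le.trans ?_
    rw [Finset.card_product, Int.card_Icc, pow_two]
    have : ((n : ℤ) + 1 - -n).toNat = 2 * n + 1 := by omega
    rw [this]
  · have key : ∀ x : ℝ, |x| ≤ 1 →
        round (n * x) ∈ Finset.Icc (-(n : ℤ)) n ∧ |(round (n * x) : ℝ) / n - x| ≤ 1 / n / 2 := by
      intro x hx
      have h1 := abs_sub_round (n * x)
      have h2 := abs_le.mp h1
      have h3 := abs_le.mp hx
      constructor
      · rw [Finset.mem_Icc]
        constructor
        · have : (-(n : ℝ) - 1) < round (n * x) := by nlinarith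
          have : -(n : ℤ) - 1 < round (n * x) := by exact_mod_cast this
          omega
        · have : (round (n * x) : ℝ) < n + 1 := by nlinarith
          have : round (n * x) < (n : ℤ) + 1 := by exact_mod_cast this
          omega
      · have : (round (n * x) : ℝ) / n - x = -((n * x - round (n * x)) / n) := by field_simp; ring
        rw [this, abs_neg, abs_div, abs_of_pos hn']
        calc _ ≤ (1 / 2) / (n : ℝ) := by gcongr
          _ = _ := by ring
    obtain ⟨m1, d1⟩ := key z.re ((Complex.abs_re_le_norm z).trans hz)
    obtain ⟨m2, d2⟩ := key z.im ((Complex.abs_im_le_norm z).trans hz)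
    refine ⟨g (round (n * z.re), round (n * z.im)),
      Finset.mem_image_of_mem _ (Finset.mem_product.mpr ⟨m1, m2⟩), ?_⟩
    refine (Complex.norm_le_abs_re_add_abs_im _).trans ?_
    simp only [Complex.sub_re, Complex.sub_im, g]
    linarith

/-- A nearly singular bounded matrix has an almost vanishing row combination whose coefficients
come from a net of the unit disc and one of whose coefficients is `1`. -/
lemma exists_net_combination {N M : ℕ} {H : Fin N × Fin M → ℂ} {K s δ : ℝ} {T : Finset ℂ}
    (hT : ∀ z : ℂ, ‖z‖ ≤ 1 → ∃ t ∈ T, ‖t - z‖ ≤ δ) (hδ : δ ≤ s) (hs : 0 ≤ s)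
    (hK : ∀ p, ‖H p‖ ≤ K) {u : Fin N → ℂ} (hu : ∑ k, ‖u k‖ ^ 2 = 1)
    (huH : ∑ j, ‖∑ k, u k * H (k, j)‖ ^ 2 ≤ s ^ 2) :
    ∃ k, ∃ w ∈ Fintype.piFinset (fun i => if i = k then {(1 : ℂ)} else T),
      ∀ j, ‖∑ i, w i * H (i, j)‖ ≤ N * (1 + K) * s := by
  have hne : Nonempty (Fin N) := by
    by_contra h
    rw [not_nonempty_iff] at h
    simp at hu
  -- The largest coordinate serves as pivot: its modulus is at least `1 / N`, and dividing by it
  -- puts all the others in the unit disc.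
  obtain ⟨k, hk⟩ := Finite.exists_max fun i => ‖u i‖
  have hN1 : (1 : ℝ) ≤ N := by
    have := Fin.pos_iff_nonempty.mpr hne
    exact_mod_cast this
  have hk1 : 1 ≤ N * ‖u k‖ := by
    have h1 : (1 : ℝ) ≤ N * ‖u k‖ ^ 2 := by
      rw [← hu]
      calc ∑ i, ‖u i‖ ^ 2 ≤ ∑ _i : Fin N, ‖u k‖ ^ 2 :=
            Finset.sum_le_sum fun i _ => pow_le_pow_left₀ (norm_nonneg _) (hk i) 2
        _ = _ := by simp
    have h2 : ‖u k‖ ≤ 1 := by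
      have h3 : ‖u k‖ ^ 2 ≤ 1 := by
        rw [← hu]
        exact Finset.single_le_sum (f := fun i => ‖u i‖ ^ 2) (fun i _ => by positivity)
          (Finset.mem_univ k)
      exact (sq_le_one_iff₀ (norm_nonneg _)).mp h3
    have := norm_nonneg (u k)
    nlinarith
  have hk0 : 0 < ‖u k‖ := by
    by_contra h
    have : ‖u k‖ = 0 := le_antisymm (not_lt.mp h) (norm_nonneg _)
    rw [this] at hk1; norm_num at hk1
  have huk : u k ≠ 0 := norm_pos_iff.mp hk0
  have hv : ∀ i, ∃ t ∈ (if i = k then {(1 : ℂ)} else T), ‖t - u i / u k‖ ≤ s := by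
    intro i
    split_ifs with hi
    · exact ⟨1, Finset.mem_singleton_self _, by rw [hi, div_self huk]; simpa using hs⟩
    · obtain ⟨t, ht, hd⟩ := hT (u i / u k) (by
        rw [norm_div, div_le_one hk0]; exact hk i)
      exact ⟨t, ht, hd.trans hδ⟩
  choose w hw hwd using hv
  refine ⟨k, w, Fintype.mem_piFinset.mpr hw, fun j => ?_⟩
  have e : ∑ i, w i * H (i, j) = (∑ i, u i * H (i, j)) / u k + ∑ i, (w i - u i / u k) * H (i, j) := by
    rw [Finset.sum_div, ← Finset.sum_add_distrib]
    refine Finset.sum_congr rfl fun i _ => ?_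
    ring
  have h1 : ‖∑ i, u i * H (i, j)‖ ≤ s := by
    refine abs_le_of_sq_le_sq' ?_ hs |>.2
    refine le_trans ?_ huH
    exact Finset.single_le_sum (f := fun j => ‖∑ k, u k * H (k, j)‖ ^ 2)
      (fun i _ => by positivity) (Finset.mem_univ j)
  rw [e]
  refine (norm_add_le _ _).trans ?_
  have h2 : ‖(∑ i, u i * H (i, j)) / u k‖ ≤ N * s := by
    rw [norm_div, div_le_iff₀ hk0]
    calc _ ≤ s := h1
      _ ≤ s * (N * ‖u k‖) := le_mul_of_one_le_right hs hk1
      _ = _ := by ring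
  have h3 : ‖∑ i, (w i - u i / u k) * H (i, j)‖ ≤ N * (s * K) := by
    refine (norm_sum_le _ _).trans ?_
    calc _ ≤ ∑ _i : Fin N, s * K := by
          refine Finset.sum_le_sum fun i _ => ?_
          rw [norm_mul]
          exact mul_le_mul (hwd i) (hK _) (norm_nonneg _) hs
      _ = _ := by simp
  linarith

open scoped ENNReal

/-- Given the other rows, each of the `M` entries of row `k` must lie in a disc of radius `r`,
because its coefficient is `1`. -/
lemma pi_measure_combination_le {N M : ℕ} {w : Fin N → ℂ} {k : Fin N} (hw : w k = 1) {r : ℝ}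
    (hr : 0 ≤ r) :
    Measure.pi (fun _ : Fin N × Fin M => stdComplexGaussian)
      {x | ∀ j, ‖∑ i, w i * x (i, j)‖ ≤ r} ≤ ENNReal.ofReal (4 * r ^ 2) ^ M := by
  let q : Fin N × Fin M → Prop := fun p => p.1 = k
  let φ : ({p // ¬ q p} → ℂ) → {p // q p} → ℂ := fun y p =>
    -∑ i, if h : i = k then 0 else w i * y ⟨(i, p.1.2), h⟩
  have hφ : Measurable φ := by
    refine measurable_pi_lambda _ fun p => (Finset.measurable_sum _ fun i _ => ?_).neg
    split_ifs with h
    · exact measurable_const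
    · exact (measurable_pi_apply _).const_mul _
  have hcard : Fintype.card {p // q p} = M := by
    have e : {p // q p} ≃ Fin M :=
      { toFun := fun p => p.1.2
        invFun := fun j => ⟨(k, j), rfl⟩
        left_inv := by rintro ⟨⟨i, j⟩, h⟩; simp only [q] at h; subst h; rfl
        right_inv := fun j => rfl }
    rw [Fintype.card_congr e, Fintype.card_fin]
  have h := pi_measure_discs_le q stdComplexGaussian hφ
    (fun a => stdComplexGaussian_closedBall_le a hr)
  rw [hcard] at h
  refine le_trans (measure_mono ?_) h
  rintro x hx ⟨⟨i, j⟩, hp⟩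
  simp only [q] at hp
  subst hp
  simp only [Metric.mem_closedBall, dist_eq_norm, φ, sub_neg_eq_add]
  refine le_trans (le_of_eq ?_) (hx j)
  congr 1
  rw [← Finset.add_sum_erase _ _ (Finset.mem_univ i),
    ← Finset.add_sum_erase _ (fun i => w i * x (i, j)) (Finset.mem_univ i)]
  simp only [dif_pos, zero_add, hw, one_mul]
  congr 1
  refine Finset.sum_congr rfl fun l hl => ?_
  rw [dif_neg (Finset.ne_of_mem_erase hl)]

/-- Union bound over the `N` pivots and the net vectors. With `n = ⌈1 / s⌉` the grid has at most `(2
n + 1)² ≤ 25 / s²` points. -/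
lemma pi_measure_nearly_singular_le {N M : ℕ} (hN : 1 ≤ N) {K s : ℝ} (hK : 0 ≤ K) (hs : 0 < s)
    (hs1 : s ≤ 1) :
    Measure.pi (fun _ : Fin N × Fin M => stdComplexGaussian)
      {x | (∀ p, ‖x p‖ ≤ K) ∧ ∃ u : Fin N → ℂ, ∑ k, ‖u k‖ ^ 2 = 1 ∧
        ∑ j, ‖∑ k, u k * x (k, j)‖ ^ 2 ≤ s ^ 2}
      ≤ ENNReal.ofReal (N * (25 / s ^ 2) ^ (N - 1) * (4 * (N * (1 + K) * s) ^ 2) ^ M) := by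
  set n := ⌈1 / s⌉₊ with hn
  have hn1 : 1 / s ≤ n := Nat.le_ceil _
  have hn0 : 0 < n := Nat.ceil_pos.mpr (by positivity)
  have hn2 : (n : ℝ) ≤ 2 / s := by
    have h1 := (Nat.ceil_lt_add_one (a := 1 / s) (by positivity)).le
    have h2 : 1 ≤ 1 / s := by rw [le_div_iff₀ hs]; linarith
    calc (n : ℝ) ≤ 1 / s + 1 := h1
      _ ≤ 1 / s + 1 / s := by linarith
      _ = _ := by ring
  obtain ⟨T, hTc, hT⟩ := exists_net_unitDisc hn0
  have hδ : 1 / (n : ℝ) ≤ s := by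
    rw [div_le_iff₀ (by exact_mod_cast hn0)]
    rw [div_le_iff₀ hs] at hn1
    linarith
  set F : Fin N → Finset (Fin N → ℂ) := fun k =>
    Fintype.piFinset (fun i => if i = k then {(1 : ℂ)} else T) with hF
  have hFc : ∀ k, ((F k).card : ℝ) ≤ (25 / s ^ 2) ^ (N - 1) := by
    intro k
    have h1 : (F k).card = T.card ^ (N - 1) := by
      simp only [hF, Fintype.card_piFinset]
      rw [← Finset.mul_prod_erase _ _ (Finset.mem_univ k)]
      simp only [if_true, Finset.card_singleton, one_mul]
      rw [Finset.prod_congr rfl (g := fun _ => T.card) (fun i hi => by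
        rw [if_neg (Finset.ne_of_mem_erase hi)])]
      simp
    have h2 : (T.card : ℝ) ≤ 25 / s ^ 2 := by
      have h3 : (T.card : ℝ) ≤ (2 * n + 1) ^ 2 := by exact_mod_cast hTc
      have h4 : (2 * n + 1 : ℝ) ≤ 5 / s := by
        have h2 : 1 ≤ 1 / s := by rw [le_div_iff₀ hs]; linarith
        have e : 5 / s = 2 * (2 / s) + 1 / s := by ring
        rw [e]; linarith
      calc (T.card : ℝ) ≤ (2 * n + 1) ^ 2 := h3
        _ ≤ (5 / s) ^ 2 := by gcongr
        _ = _ := by rw [div_pow]; norm_num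
    rw [h1]; push_cast
    gcongr
  set r := N * (1 + K) * s with hr
  have hr0 : 0 ≤ r := by positivity
  have hsub : {x : Fin N × Fin M → ℂ | (∀ p, ‖x p‖ ≤ K) ∧ ∃ u : Fin N → ℂ, ∑ k, ‖u k‖ ^ 2 = 1 ∧
        ∑ j, ‖∑ k, u k * x (k, j)‖ ^ 2 ≤ s ^ 2}
      ⊆ ⋃ k, ⋃ w ∈ F k, {x | ∀ j, ‖∑ i, w i * x (i, j)‖ ≤ r} := by
    rintro x ⟨hxK, u, hu, hux⟩
    obtain ⟨k, w, hw, hwx⟩ := exists_net_combination hT hδ hs.le hxK hu hux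
    simp only [Set.mem_iUnion]
    exact ⟨k, w, hw, hwx⟩
  have hset : ∀ k, ∀ w ∈ F k, w k = 1 := by
    intro k w hw
    have := Fintype.mem_piFinset.mp hw k
    simpa using this
  calc _ ≤ _ := measure_mono hsub
    _ ≤ ∑ k, Measure.pi (fun _ : Fin N × Fin M => stdComplexGaussian)
          (⋃ w ∈ F k, {x | ∀ j, ‖∑ i, w i * x (i, j)‖ ≤ r}) := measure_iUnion_fintype_le _ _
    _ ≤ ∑ k : Fin N, ENNReal.ofReal ((25 / s ^ 2) ^ (N - 1) * (4 * r ^ 2) ^ M) := by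
        refine Finset.sum_le_sum fun k _ => ?_
        refine (measure_biUnion_finset_le _ _).trans ?_
        calc _ ≤ ∑ w ∈ F k, ENNReal.ofReal (4 * r ^ 2) ^ M :=
              Finset.sum_le_sum fun w hw => pi_measure_combination_le (hset k w hw) hr0
          _ = ENNReal.ofReal ((F k).card * (4 * r ^ 2) ^ M) := by
              rw [Finset.sum_const, nsmul_eq_mul, ← ENNReal.ofReal_pow (by positivity),
                ← ENNReal.ofReal_natCast, ← ENNReal.ofReal_mul (by positivity)]
          _ ≤ _ := by
              refine ENNReal.ofReal_le_ofReal ?_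
              gcongr
              exact hFc k
    _ = _ := by
        rw [Finset.sum_const, Finset.card_univ, Fintype.card_fin, nsmul_eq_mul,
          ← ENNReal.ofReal_natCast, ← ENNReal.ofReal_mul (by positivity), mul_assoc]

lemma exists_pi_measure_large_entry_le (N M p : ℕ) :
    ∃ C : ℝ, 0 < C ∧ ∀ K : ℝ, 0 < K →
      Measure.pi (fun _ : Fin N × Fin M => stdComplexGaussian) {x | ∃ i, K < ‖x i‖}
        ≤ ENNReal.ofReal (C / K ^ p) := by
  obtain ⟨C, hC, h⟩ := exists_stdComplexGaussian_tail p
  refine ⟨N * M * C + 1, by positivity, fun K hK => ?_⟩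
  have hm : MeasurableSet {z : ℂ | K < ‖z‖} := measurableSet_lt measurable_const measurable_norm
  have hsub : {x : Fin N × Fin M → ℂ | ∃ i, K < ‖x i‖}
      ⊆ ⋃ i, (fun x : Fin N × Fin M → ℂ => x i) ⁻¹' {z | K < ‖z‖} := by
    rintro x ⟨i, hi⟩
    exact Set.mem_iUnion.mpr ⟨i, hi⟩
  calc _ ≤ _ := measure_mono hsub
    _ ≤ ∑ i : Fin N × Fin M, Measure.pi (fun _ : Fin N × Fin M => stdComplexGaussian)
          ((fun x : Fin N × Fin M → ℂ => x i) ⁻¹' {z | K < ‖z‖}) := measure_iUnion_fintype_le _ _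
    _ ≤ ∑ _i : Fin N × Fin M, ENNReal.ofReal (C / K ^ p) := by
        refine Finset.sum_le_sum fun i _ => ?_
        rw [(measurePreserving_eval (fun _ : Fin N × Fin M => stdComplexGaussian)
          i).measure_preimage hm.nullMeasurableSet]
        exact h K hK
    _ = ENNReal.ofReal (N * M * (C / K ^ p)) := by
        rw [Finset.sum_const, Finset.card_univ, Fintype.card_prod, Fintype.card_fin,
          Fintype.card_fin, nsmul_eq_mul, ← ENNReal.ofReal_natCast,
          ← ENNReal.ofReal_mul (by positivity)]
        push_cast; rfl
    _ ≤ _ := by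
        refine ENNReal.ofReal_le_ofReal ?_
        rw [← mul_div_assoc]
        gcongr
        linarith

end Covering

/-! ### Upper bound on the outage probability. -/

section UpperBound

variable {Ω : Type*} [MeasurableSpace Ω] {P : Measure Ω} [IsProbabilityMeasure P] {N M : ℕ}
  {H : Ω → Matrix (Fin N) (Fin M) ℂ}

theorem outageProb_le (hN : 1 ≤ N) (hNM : N ≤ M) (hH : IsGaussianChannel H P) {R : ℝ} (hR : 0 < R)
    (p : ℕ) : ∃ C ρ₀ : ℝ, 0 < C ∧ 0 < ρ₀ ∧ ∀ ρ K : ℝ, ρ₀ ≤ ρ → 1 ≤ K →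
      outageProb P (fun ω k => sinrWienerZF ρ (H ω) k) R
        ≤ C * (K ^ (2 * M) / ρ ^ (M - N + 1) + 1 / K ^ p) := by
  obtain ⟨C₁, hC₁, htail⟩ := exists_pi_measure_large_entry_le N M p
  have hN0 : (0 : ℝ) < N := by exact_mod_cast hN
  -- Chosen so that `a / ρ` is the threshold in `exists_unit_of_outage`; it also serves as `ρ₀`,
  -- which ensures `s ≤ 1`.
  set a : ℝ := 4 * N * 2 ^ R * N with ha
  have ha0 : 0 < a := by positivity
  set C₂ : ℝ := N * 25 ^ (N - 1) * (16 * N ^ 2) ^ M * a ^ (M - N + 1) with hC₂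
  have hC₂0 : 0 < C₂ := by positivity
  refine ⟨C₁ + C₂, a, by positivity, ha0, fun ρ K hρ hK => ?_⟩
  have hρ0 : 0 < ρ := ha0.trans_le hρ
  have hK0 : 0 < K := by linarith
  set s : ℝ := √(a / ρ) with hs
  have hs2 : s ^ 2 = a / ρ := Real.sq_sqrt (by positivity)
  have hs0 : 0 < s := Real.sqrt_pos.mpr (by positivity)
  have hs1 : s ≤ 1 := Real.sqrt_le_one.mpr (by rw [div_le_one hρ0]; exact hρ)
  set S₁ : Set (Fin N × Fin M → ℂ) := {x | (∀ p, ‖x p‖ ≤ K) ∧ ∃ u : Fin N → ℂ,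
    ∑ k, ‖u k‖ ^ 2 = 1 ∧ ∑ j, ‖∑ k, u k * x (k, j)‖ ^ 2 ≤ s ^ 2}
  set S₂ : Set (Fin N × Fin M → ℂ) := {x | ∃ i, K < ‖x i‖}
  have hsub : {ω | ∑ k, Real.logb 2 (1 + sinrWienerZF ρ (H ω) k) ≤ R}
      ⊆ {ω | (fun p : Fin N × Fin M => H ω p.1 p.2) ∈ S₁ ∪ S₂} := by
    intro ω hω
    obtain ⟨u, hu, huH⟩ := exists_unit_of_outage hN hρ0 hR hω
    by_cases h : ∀ p : Fin N × Fin M, ‖H ω p.1 p.2‖ ≤ K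
    · exact Or.inl ⟨h, u, hu, huH.trans (le_of_eq (by rw [hs2, ha]; ring))⟩
    · push Not at h
      exact Or.inr h
  have hE : N * (25 / s ^ 2) ^ (N - 1) * (4 * (N * (1 + K) * s) ^ 2) ^ M
      ≤ C₂ * (K ^ (2 * M) / ρ ^ (M - N + 1)) := by
    have h1 : (1 + K) ^ 2 ≤ 4 * K ^ 2 := by nlinarith
    calc N * (25 / s ^ 2) ^ (N - 1) * (4 * (N * (1 + K) * s) ^ 2) ^ M
        = N * (25 / s ^ 2) ^ (N - 1) * (4 * (N ^ 2 * (1 + K) ^ 2 * s ^ 2)) ^ M := by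
          rw [mul_pow (N * (1 + K)) s 2, mul_pow (N : ℝ) (1 + K) 2]
      _ ≤ N * (25 / s ^ 2) ^ (N - 1) * (4 * (N ^ 2 * (4 * K ^ 2) * s ^ 2)) ^ M := by gcongr
      _ = N * 25 ^ (N - 1) * (16 * N ^ 2) ^ M * K ^ (2 * M) *
            ((s ^ 2) ^ M / (s ^ 2) ^ (N - 1)) := by
          have e : 4 * ((N : ℝ) ^ 2 * (4 * K ^ 2) * s ^ 2) = (16 * N ^ 2) * K ^ 2 * s ^ 2 := by ring
          rw [e, mul_pow, mul_pow, div_pow, pow_mul K 2 M]; ring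
      _ = N * 25 ^ (N - 1) * (16 * N ^ 2) ^ M * K ^ (2 * M) * (a / ρ) ^ (M - N + 1) := by
          congr 1
          rw [div_eq_iff (by positivity), hs2, ← pow_add]
          congr 1; omega
      _ = C₂ * (K ^ (2 * M) / ρ ^ (M - N + 1)) := by
          rw [hC₂, div_pow]; ring
  have hP : P {ω | ∑ k, Real.logb 2 (1 + sinrWienerZF ρ (H ω) k) ≤ R}
      ≤ ENNReal.ofReal ((C₁ + C₂) * (K ^ (2 * M) / ρ ^ (M - N + 1) + 1 / K ^ p)) := by
    calc _ ≤ _ := measure_mono hsub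
      _ ≤ _ := hH.measure_le _
      _ ≤ _ := measure_union_le _ _
      _ ≤ _ := add_le_add (pi_measure_nearly_singular_le hN hK0.le hs0 hs1) (htail K hK0)
      _ ≤ ENNReal.ofReal (C₂ * (K ^ (2 * M) / ρ ^ (M - N + 1)) + C₁ / K ^ p) := by
          rw [← ENNReal.ofReal_add (by positivity) (by positivity)]
          gcongr
      _ ≤ _ := by
          refine ENNReal.ofReal_le_ofReal ?_
          have h1 : 0 ≤ K ^ (2 * M) / ρ ^ (M - N + 1) := by positivity
          have h2 : 0 ≤ 1 / K ^ p := by positivity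
          have h3 : C₁ / K ^ p = C₁ * (1 / K ^ p) := by ring
          rw [h3]
          nlinarith [mul_nonneg hC₁.le h1, mul_nonneg hC₂0.le h2]
  rw [outageProb, Measure.real]
  exact ENNReal.toReal_le_of_le_ofReal (by positivity) hP

end UpperBound

/-! ### Nearly singular matrices with a spread-out null vector. -/

section NearSingular

variable {n m : ℕ}

/-- A matrix whose first `n` columns are annihilated by the all-ones row vector. -/
def baseEntry (n m : ℕ) (p : Fin (n + 1) × Fin (n + (m + 1))) : ℂ :=
  if p.1 = Fin.last n then -1 else if (p.1 : ℕ) = p.2 then 1 else 0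

lemma norm_baseEntry_le (p : Fin (n + 1) × Fin (n + (m + 1))) : ‖baseEntry n m p‖ ≤ 1 := by
  unfold baseEntry; split_ifs <;> simp

lemma sum_mul_baseEntry (u : Fin (n + 1) → ℂ) (j : Fin n) :
    ∑ i, u i * baseEntry n m (i, Fin.castAdd (m + 1) j) = u j.castSucc - u (Fin.last n) := by
  rw [Fin.sum_univ_castSucc]
  have h1 : ∀ i : Fin n, u i.castSucc * baseEntry n m (i.castSucc, Fin.castAdd (m + 1) j)
      = if i = j then u i.castSucc else 0 := fun i => by
    simp [baseEntry, (Fin.castSucc_lt_last i).ne, Fin.ext_iff]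
  simp only [h1]
  simp [baseEntry, sub_eq_add_neg]

/-- The entries of the last row beyond the first `n` columns. -/
def IsTail (p : Fin (n + 1) × Fin (n + (m + 1))) : Prop := p.1 = Fin.last n ∧ n ≤ (p.2 : ℕ)

instance : DecidablePred (IsTail (n := n) (m := m)) := fun p => by
  unfold IsTail; infer_instance

lemma not_isTail_castSucc (i : Fin n) (j : Fin (n + (m + 1))) : ¬ IsTail (i.castSucc, j) :=
  fun h => (Fin.castSucc_lt_last i).ne h.1

lemma not_isTail_castAdd (i : Fin (n + 1)) (j : Fin n) : ¬ IsTail (i, Fin.castAdd (m + 1) j) :=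
  fun h => by have := h.2; simp at this; omega

/-- With `N = n + 1` and `M = n + m + 1` this count is `M - N + 1`, the diversity order. -/
lemma card_isTail : Fintype.card {p : Fin (n + 1) × Fin (n + (m + 1)) // IsTail p} = m + 1 := by
  have e : {p : Fin (n + 1) × Fin (n + (m + 1)) // IsTail p} ≃ Fin (m + 1) :=
    { toFun := fun p => ⟨p.1.2 - n, by have := p.1.2.2; have := p.2.2; omega⟩
      invFun := fun j => ⟨(Fin.last n, Fin.natAdd n j), rfl, by simp⟩
      left_inv := by
        rintro ⟨⟨i, j⟩, h⟩
        have h1 := h.1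
        have h2 := h.2
        simp only at h1 h2
        subst h1
        exact Subtype.ext (Prod.ext rfl (Fin.ext (Nat.add_sub_cancel' h2)))
      right_inv := fun j => by simp }
  rw [Fintype.card_congr e, Fintype.card_fin]

/-- If `x` is close to the base matrix off the tail, then a unit vector that almost annihilates
`x` has all its coordinates bounded below. -/
lemma spread_of_close {x : Fin (n + 1) × Fin (n + (m + 1)) → ℂ} {η e : ℝ} (he : 0 ≤ e)
    (hη : η ≤ 1 / (8 * ((n + 1 : ℕ) : ℝ) ^ 2)) (he' : e ≤ 1 / (8 * ((n + 1 : ℕ) : ℝ)))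
    (hx : ∀ p, ¬ IsTail p → ‖x p - baseEntry n m p‖ ≤ η) {u : Fin (n + 1) → ℂ}
    (hu : ∑ k, ‖u k‖ ^ 2 = 1) (hux : ∑ j, ‖∑ k, u k * x (k, j)‖ ^ 2 ≤ e ^ 2) (k : Fin (n + 1)) :
    1 / (4 * ((n + 1 : ℕ) : ℝ)) ≤ ‖u k‖ ^ 2 := by
  set N : ℝ := ((n + 1 : ℕ) : ℝ) with hN
  have hN1 : 1 ≤ N := by rw [hN]; push_cast; linarith [(Nat.cast_nonneg n : (0 : ℝ) ≤ n)]
  have hle1 : ∀ i, ‖u i‖ ≤ 1 := fun i => by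
    have h3 : ‖u i‖ ^ 2 ≤ 1 := by
      rw [← hu]
      exact Finset.single_le_sum (f := fun i => ‖u i‖ ^ 2) (fun i _ => by positivity)
        (Finset.mem_univ i)
    exact (sq_le_one_iff₀ (norm_nonneg _)).mp h3
  -- Column `j` of the base matrix compares coordinate `j` with the last one; the errors `e` and `N
  -- η` are each at most `1 / (8 N)`.
  have hdiff : ∀ i, ‖u i - u (Fin.last n)‖ ≤ 1 / (4 * N) := by
    intro i
    refine Fin.lastCases ?_ (fun j => ?_) i
    · simp; positivity
    · have h1 : ‖∑ k, u k * x (k, Fin.castAdd (m + 1) j)‖ ≤ e := by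
        refine (abs_le_of_sq_le_sq' ?_ he).2
        refine le_trans ?_ hux
        exact Finset.single_le_sum (f := fun j => ‖∑ k, u k * x (k, j)‖ ^ 2)
          (fun i _ => by positivity) (Finset.mem_univ _)
      have h2 : u j.castSucc - u (Fin.last n) = ∑ k, u k * x (k, Fin.castAdd (m + 1) j)
          - ∑ k, u k * (x (k, Fin.castAdd (m + 1) j)
            - baseEntry n m (k, Fin.castAdd (m + 1) j)) := by
        rw [← sum_mul_baseEntry (m := m), ← Finset.sum_sub_distrib]
        refine Finset.sum_congr rfl fun k _ => ?_
        ring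
      have h3 : ‖∑ k, u k * (x (k, Fin.castAdd (m + 1) j)
            - baseEntry n m (k, Fin.castAdd (m + 1) j))‖ ≤ N * η := by
        refine (norm_sum_le _ _).trans ?_
        calc _ ≤ ∑ _k : Fin (n + 1), 1 * η := by
              refine Finset.sum_le_sum fun k _ => ?_
              rw [norm_mul]
              exact mul_le_mul (hle1 k) (hx _ (not_isTail_castAdd k j)) (norm_nonneg _) zero_le_one
          _ = _ := by rw [Finset.sum_const, Finset.card_univ, Fintype.card_fin]; simp [hN]
      have h4 : N * η ≤ 1 / (8 * N) := by
        calc N * η ≤ N * (1 / (8 * N ^ 2)) := by gcongr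
          _ = _ := by field_simp
      rw [h2]
      refine (norm_sub_le _ _).trans ?_
      have h5 : 1 / (4 * N) = 1 / (8 * N) + 1 / (8 * N) := by field_simp; norm_num
      rw [h5]
      linarith
  obtain ⟨i, hi⟩ := Finite.exists_max fun i => ‖u i‖
  have hi1 : 1 / N ≤ ‖u i‖ ^ 2 := by
    rw [div_le_iff₀ (by linarith), ← hu]
    calc ∑ k, ‖u k‖ ^ 2 ≤ ∑ _k : Fin (n + 1), ‖u i‖ ^ 2 :=
          Finset.sum_le_sum fun k _ => pow_le_pow_left₀ (norm_nonneg _) (hi k) 2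
      _ = _ := by rw [Finset.sum_const, Finset.card_univ, Fintype.card_fin, nsmul_eq_mul]; ring
  have hi2 : 1 / N ≤ ‖u i‖ := by nlinarith [norm_nonneg (u i), hle1 i]
  have hik : ‖u i‖ - ‖u k‖ ≤ 1 / (4 * N) + 1 / (4 * N) := by
    refine (norm_sub_norm_le _ _).trans ?_
    have : u i - u k = (u i - u (Fin.last n)) - (u k - u (Fin.last n)) := by ring
    rw [this]
    exact (norm_sub_le _ _).trans (add_le_add (hdiff i) (hdiff k))
  have h6 : 1 / (4 * N) + 1 / (4 * N) = 1 / N / 2 := by field_simp; norm_num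
  -- Coordinates differ in modulus by at most `1 / (2 N)`, which is at most half of the largest one.
  have h7 : ‖u i‖ / 2 ≤ ‖u k‖ := by linarith
  have h8 : 1 / (4 * N) = 1 / N / 4 := by field_simp
  rw [h8]
  nlinarith [norm_nonneg (u i)]

/-- The leading square block, read off the entries outside the tail. -/
def leadingBlock (y : {p : Fin (n + 1) × Fin (n + (m + 1)) // ¬ IsTail p} → ℂ) :
    Matrix (Fin n) (Fin n) ℂ :=
  Matrix.of fun i j => y ⟨(i.castSucc, Fin.castAdd (m + 1) j), not_isTail_castSucc _ _⟩

/-- The leading part of the last row. -/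
def lastRow (y : {p : Fin (n + 1) × Fin (n + (m + 1)) // ¬ IsTail p} → ℂ) : Fin n → ℂ :=
  fun j => y ⟨(Fin.last n, Fin.castAdd (m + 1) j), not_isTail_castAdd _ _⟩

/-- Coefficients of the row combination that cancels the last row on the first `n` columns. -/
noncomputable def cancelCoeff (y : {p : Fin (n + 1) × Fin (n + (m + 1)) // ¬ IsTail p} → ℂ) :
    Fin n → ℂ :=
  fun i => ∑ j, -lastRow y j * (leadingBlock y)⁻¹ j i

/-- The tail of the last row for which the matrix becomes singular. -/
noncomputable def singularTail
    (y : {p : Fin (n + 1) × Fin (n + (m + 1)) // ¬ IsTail p} → ℂ)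
    (p : {p : Fin (n + 1) × Fin (n + (m + 1)) // IsTail p}) : ℂ :=
  -∑ i, cancelCoeff y i * y ⟨(i.castSucc, p.1.2), not_isTail_castSucc _ _⟩

/-- Inversion is discontinuous at singular blocks, but the formula `det⁻¹ • adjugate` is measurable
everywhere. -/
lemma measurable_cancelCoeff (i : Fin n) :
    Measurable fun y : {p : Fin (n + 1) × Fin (n + (m + 1)) // ¬ IsTail p} → ℂ =>
      cancelCoeff y i := by
  have hD : Continuous (leadingBlock (n := n) (m := m)) :=
    continuous_matrix fun i j => continuous_apply _
  refine Finset.measurable_sum _ fun j _ => ?_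
  refine Measurable.mul (measurable_pi_apply _).neg ?_
  simp only [Matrix.inv_def, Ring.inverse_eq_inv', Matrix.smul_apply, smul_eq_mul]
  exact (hD.matrix_det.measurable.inv).mul
    ((continuous_apply_apply j i).comp hD.matrix_adjugate).measurable

lemma measurable_singularTail : Measurable (singularTail (n := n) (m := m)) := by
  refine measurable_pi_lambda _ fun p => (Finset.measurable_sum _ fun i _ => ?_).neg
  exact (measurable_cancelCoeff i).mul (measurable_pi_apply _)

variable {y : {p : Fin (n + 1) × Fin (n + (m + 1)) // ¬ IsTail p} → ℂ} {η : ℝ}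

/-- The block is an entrywise `η`-perturbation of the identity, hence strictly diagonally dominant.
-/
lemma isUnit_leadingBlock (hη : (n + 1) * η ≤ 1 / 8)
    (hy : ∀ p, ‖y p - baseEntry n m p‖ ≤ η) : IsUnit (leadingBlock y).det := by
  rw [isUnit_iff_ne_zero]
  refine det_ne_zero_of_sum_row_lt_diag fun k => ?_
  have h1 : ∑ j ∈ Finset.univ.erase k, ‖leadingBlock y k j‖ ≤ n * η := by
    calc _ ≤ ∑ j ∈ Finset.univ.erase k, η := by
          refine Finset.sum_le_sum fun j hj => ?_
          have := hy ⟨(k.castSucc, Fin.castAdd (m + 1) j), not_isTail_castSucc _ _⟩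
          have hne : (k : ℕ) ≠ j := fun h => Finset.ne_of_mem_erase hj (Fin.ext h).symm
          simp only [baseEntry, (Fin.castSucc_lt_last k).ne, if_false, Fin.val_castSucc,
            Fin.val_castAdd, hne, sub_zero] at this
          exact this
      _ ≤ ∑ _j : Fin n, η := by
          refine Finset.sum_le_sum_of_subset_of_nonneg (Finset.subset_univ _) fun _ _ _ => ?_
          exact (norm_nonneg _).trans
            (hy ⟨(k.castSucc, Fin.castAdd (m + 1) k), not_isTail_castSucc _ _⟩)
      _ = _ := by simp
  have h2 : 1 - η ≤ ‖leadingBlock y k k‖ := by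
    have := hy ⟨(k.castSucc, Fin.castAdd (m + 1) k), not_isTail_castSucc _ _⟩
    simp only [baseEntry, (Fin.castSucc_lt_last k).ne, if_false, Fin.val_castSucc,
      Fin.val_castAdd, if_true] at this
    have h3 := norm_sub_norm_le (1 : ℂ) (leadingBlock y k k)
    rw [norm_sub_rev, norm_one] at h3
    have h4 : ‖leadingBlock y k k - 1‖ ≤ η := this
    linarith
  linarith

lemma sum_cancelCoeff_mul (hη : (n + 1) * η ≤ 1 / 8)
    (hy : ∀ p, ‖y p - baseEntry n m p‖ ≤ η) (j : Fin n) :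
    ∑ i, cancelCoeff y i * leadingBlock y i j = -lastRow y j := by
  have h1 : (fun i => cancelCoeff y i) = Matrix.vecMul (-lastRow y) (leadingBlock y)⁻¹ := by
    funext i; rfl
  have h2 : Matrix.vecMul (fun i => cancelCoeff y i) (leadingBlock y) = -lastRow y := by
    rw [h1, Matrix.vecMul_vecMul, Matrix.nonsing_inv_mul _ (isUnit_leadingBlock hη hy),
      Matrix.vecMul_one]
  exact congrFun h2 j

/-- At the largest coefficient `c k`, the linear system gives `‖c k‖ ≤ 1 + η + n η ‖c k‖`, which can
be absorbed. -/
lemma norm_cancelCoeff_le (hη : (n + 1) * η ≤ 1 / 8)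
    (hy : ∀ p, ‖y p - baseEntry n m p‖ ≤ η) (i : Fin n) : ‖cancelCoeff y i‖ ≤ 2 := by
  have : Nonempty (Fin n) := ⟨i⟩
  obtain ⟨k, hk⟩ := Finite.exists_max fun i => ‖cancelCoeff y i‖
  refine (hk i).trans ?_
  have h := sum_cancelCoeff_mul hη hy k
  set c := cancelCoeff y with hc
  have hd : ∀ l, ‖leadingBlock y l k - if l = k then 1 else 0‖ ≤ η := fun l => by
    have := hy ⟨(l.castSucc, Fin.castAdd (m + 1) k), not_isTail_castSucc _ _⟩
    simp only [baseEntry, (Fin.castSucc_lt_last l).ne, if_false, Fin.val_castSucc,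
      Fin.val_castAdd, ← Fin.ext_iff] at this
    exact this
  have hb : ‖lastRow y k‖ ≤ 1 + η := by
    have := hy ⟨(Fin.last n, Fin.castAdd (m + 1) k), not_isTail_castAdd _ _⟩
    simp only [baseEntry, if_true] at this
    have h4 : ‖lastRow y k - (-1)‖ ≤ η := this
    have h5 := norm_sub_norm_le (lastRow y k) (-1)
    rw [norm_neg, norm_one] at h5
    linarith
  have e : c k = -lastRow y k - ∑ l, c l * (leadingBlock y l k - if l = k then 1 else 0) := by
    simp only [mul_sub, Finset.sum_sub_distrib, h]
    simp
  have h2 : ‖∑ l, c l * (leadingBlock y l k - if l = k then 1 else 0)‖ ≤ n * (‖c k‖ * η) := by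
    refine (norm_sum_le _ _).trans ?_
    calc _ ≤ ∑ _l : Fin n, ‖c k‖ * η := by
          refine Finset.sum_le_sum fun l _ => ?_
          rw [norm_mul]
          exact mul_le_mul (hk l) (hd l) (norm_nonneg _) (norm_nonneg _)
      _ = _ := by simp
  have h3 : ‖c k‖ ≤ (1 + η) + n * (‖c k‖ * η) := by
    calc ‖c k‖ = ‖-lastRow y k - ∑ l, c l * (leadingBlock y l k - if l = k then 1 else 0)‖ := by
          rw [← e]
      _ ≤ _ := (norm_sub_le _ _).trans (add_le_add (by rwa [norm_neg]) h2)
  have hη0 : 0 ≤ η := (norm_nonneg _).trans (hd k)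
  have h4 : (n : ℝ) * η ≤ 1 / 8 := by nlinarith
  have h5 : η ≤ 1 / 8 := by nlinarith [(Nat.cast_nonneg n : (0 : ℝ) ≤ n)]
  nlinarith [norm_nonneg (c k)]

/-- Keeps the disc centres in the unit disc, where `exists_le_stdComplexGaussian_closedBall`
applies. The base entries above the tail are `0`, so each summand is at most `2 η`. -/
lemma norm_singularTail_le (hη : (n + 1) * η ≤ 1 / 8)
    (hy : ∀ p, ‖y p - baseEntry n m p‖ ≤ η)
    (p : {p : Fin (n + 1) × Fin (n + (m + 1)) // IsTail p}) : ‖singularTail y p‖ ≤ 1 := by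
  rw [singularTail, norm_neg]
  refine (norm_sum_le _ _).trans ?_
  have hnη : (n : ℝ) * η ≤ 1 / 8 := by
    -- For `n = 0` every entry is in the tail and nothing forces `0 ≤ η`.
    rcases n.eq_zero_or_pos with h0 | h0
    · rw [h0]; norm_num
    · have hη0 : 0 ≤ η := (norm_nonneg _).trans
        (hy ⟨(Fin.castSucc ⟨0, h0⟩, p.1.2), not_isTail_castSucc _ _⟩)
      linarith
  calc _ ≤ ∑ _i : Fin n, 2 * η := by
        refine Finset.sum_le_sum fun i _ => ?_
        rw [norm_mul]
        refine mul_le_mul (norm_cancelCoeff_le hη hy i) ?_ (norm_nonneg _) (by norm_num)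
        have := hy ⟨(i.castSucc, p.1.2), not_isTail_castSucc _ _⟩
        have h2 := p.2.2
        have hne : (i : ℕ) ≠ p.1.2 := by have := i.2; omega
        simpa [baseEntry, (Fin.castSucc_lt_last i).ne, hne] using this
    _ = 2 * (n * η) := by simp; ring
    _ ≤ 1 := by linarith

/-- A matrix whose tail is close to the singular one is almost annihilated by a row combination
with last coefficient `1`. -/
lemma exists_almost_null {x : Fin (n + 1) × Fin (n + (m + 1)) → ℂ} {r : ℝ}
    (hη : (n + 1) * η ≤ 1 / 8)
    (hx : ∀ p, ¬ IsTail p → ‖x p - baseEntry n m p‖ ≤ η)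
    (hr : ∀ p : {p : Fin (n + 1) × Fin (n + (m + 1)) // IsTail p},
      ‖x p - singularTail (fun p => x p) p‖ ≤ r) :
    ∃ w : Fin (n + 1) → ℂ, w (Fin.last n) = 1 ∧
      ∑ j, ‖∑ k, w k * x (k, j)‖ ^ 2 ≤ (m + 1) * r ^ 2 := by
  set y : {p : Fin (n + 1) × Fin (n + (m + 1)) // ¬ IsTail p} → ℂ := fun p => x p with hy
  refine ⟨Fin.snoc (α := fun _ => ℂ) (cancelCoeff y) 1, by simp, ?_⟩
  rw [Fin.sum_univ_add]
  have h1 : ∀ j : Fin n, ∑ k, Fin.snoc (α := fun _ => ℂ) (cancelCoeff y) 1 k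
      * x (k, Fin.castAdd (m + 1) j) = 0 := fun j => by
    rw [Fin.sum_univ_castSucc]
    simp only [Fin.snoc_castSucc, Fin.snoc_last, one_mul]
    have := sum_cancelCoeff_mul hη (fun p : {p // ¬ IsTail p} => hx p.1 p.2) j
    have h2 : ∑ i : Fin n, cancelCoeff y i * x (i.castSucc, Fin.castAdd (m + 1) j)
      = -x (Fin.last n, Fin.castAdd (m + 1) j) := this
    rw [h2]; ring
  have h2 : ∀ j : Fin (m + 1), ‖∑ k, Fin.snoc (α := fun _ => ℂ) (cancelCoeff y) 1 k
      * x (k, Fin.natAdd n j)‖ ≤ r := fun j => by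
    rw [Fin.sum_univ_castSucc]
    simp only [Fin.snoc_castSucc, Fin.snoc_last, one_mul]
    have := hr ⟨(Fin.last n, Fin.natAdd n j), rfl, by simp⟩
    rw [singularTail, sub_neg_eq_add, add_comm] at this
    exact this
  simp only [h1]
  calc _ = ∑ j : Fin (m + 1), ‖∑ k, Fin.snoc (α := fun _ => ℂ) (cancelCoeff y) 1 k
      * x (k, Fin.natAdd n j)‖ ^ 2 := by simp
    _ ≤ ∑ _j : Fin (m + 1), r ^ 2 :=
        Finset.sum_le_sum fun j _ => pow_le_pow_left₀ (norm_nonneg _) (h2 j) 2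
    _ = _ := by simp

end NearSingular

/-! ### Lower bound on the outage probability. -/

section LowerBound

open scoped ENNReal

variable {Ω : Type*} [MeasurableSpace Ω] {P : Measure Ω} [IsProbabilityMeasure P]

theorem le_outageProb_aux {n m : ℕ} {H : Ω → Matrix (Fin (n + 1)) (Fin (n + (m + 1))) ℂ}
    (hH : IsGaussianChannel H P) {R : ℝ} (hR : 0 < R) :
    ∃ C ρ₀ : ℝ, 0 < C ∧ 0 < ρ₀ ∧ ∀ ρ : ℝ, ρ₀ ≤ ρ →
      C / ρ ^ (m + 1) ≤ outageProb P (fun ω k => sinrWienerZF ρ (H ω) k) R := by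
  obtain ⟨c, hc, hball⟩ := exists_le_stdComplexGaussian_closedBall
  set N : ℝ := ((n + 1 : ℕ) : ℝ) with hN
  have hN1 : 1 ≤ N := by rw [hN]; push_cast; linarith [(Nat.cast_nonneg n : (0 : ℝ) ≤ n)]
  set η : ℝ := 1 / (8 * N ^ 2) with hη
  have hη0 : 0 < η := by positivity
  have hη1 : η ≤ 1 := by rw [hη, div_le_one (by positivity)]; nlinarith
  have hη8 : ((n : ℝ) + 1) * η ≤ 1 / 8 := by
    have : (n : ℝ) + 1 = N := by rw [hN]; push_cast; rfl
    rw [this, hη, mul_one_div, div_le_div_iff₀ (by positivity) (by norm_num)]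
    nlinarith
  set t : ℝ := (2 ^ (R / N) - 1) / (4 * N) with ht
  have ht0 : 0 < t := by
    have : (1 : ℝ) < 2 ^ (R / N) := Real.one_lt_rpow (by norm_num) (by positivity)
    exact div_pos (by linarith) (by positivity)
  set V : Set ({p : Fin (n + 1) × Fin (n + (m + 1)) // ¬ IsTail p} → ℂ) :=
    Set.univ.pi fun p => Metric.closedBall (baseEntry n m p) η with hV
  have hVm : MeasurableSet V := MeasurableSet.univ_pi fun p => measurableSet_closedBall
  set v := (Measure.pi fun _ : {p : Fin (n + 1) × Fin (n + (m + 1)) // ¬ IsTail p} =>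
    stdComplexGaussian).real V with hv
  have hv0 : 0 < v := by
    rw [hv, Measure.real, Measure.pi_pi, ENNReal.toReal_prod]
    refine Finset.prod_pos fun p _ => ENNReal.toReal_pos ?_ (measure_ne_top _ _)
    have := hball (baseEntry n m p) η (norm_baseEntry_le _) hη0.le hη1
    exact (lt_of_lt_of_le (ENNReal.ofReal_pos.mpr (by positivity)) this).ne'
  -- The constant is `v`, independent of `ρ`, times `m + 1` disc bounds `c r²` with `1 / ρ` taken
  -- out; `ρ₀` is what `e ≤ 1 / (8 N)` requires.
  refine ⟨(c * (t * N / (m + 1))) ^ (m + 1) * v, t * N * (64 * N ^ 2), by positivity,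
    by positivity, fun ρ hρ => ?_⟩
  have hρ0 : 0 < ρ := lt_of_lt_of_le (by positivity) hρ
  set e : ℝ := √(t * (N / ρ)) with he
  have he2 : e ^ 2 = t * (N / ρ) := Real.sq_sqrt (by positivity)
  have he8 : e ≤ 1 / (8 * N) := by
    refine Real.sqrt_le_iff.mpr ⟨by positivity, ?_⟩
    rw [div_pow, mul_div_assoc', div_le_div_iff₀ hρ0 (by positivity)]
    nlinarith
  -- The `m + 1` tail columns together contribute `(m + 1) r² = t N / ρ`, exactly the allowed
  -- threshold.
  set r : ℝ := √(t * N / (m + 1) / ρ) with hr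
  have hr2 : r ^ 2 = t * N / (m + 1) / ρ := Real.sq_sqrt (by positivity)
  have hr0 : 0 ≤ r := Real.sqrt_nonneg _
  have hr1 : r ≤ 1 := by
    refine Real.sqrt_le_one.mpr ?_
    rw [div_div, div_le_one (by positivity)]
    have hm : (0 : ℝ) ≤ m := Nat.cast_nonneg m
    have h1 : t * N ≤ ρ := by
      refine le_trans ?_ hρ
      exact le_mul_of_one_le_right (by positivity) (by nlinarith)
    nlinarith
  set S : Set (Fin (n + 1) × Fin (n + (m + 1)) → ℂ) :=
    {x | (fun i : {p : Fin (n + 1) × Fin (n + (m + 1)) // ¬ IsTail p} => x i) ∈ V ∧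
        ∀ i : {p : Fin (n + 1) × Fin (n + (m + 1)) // IsTail p}, x i ∈ Metric.closedBall
          (singularTail (fun i : {p : Fin (n + 1) × Fin (n + (m + 1)) // ¬ IsTail p} => x i) i) r}
  have hSmeas : MeasurableSet S := by
    have hres : Measurable fun (x : Fin (n + 1) × Fin (n + (m + 1)) → ℂ)
        (i : {p : Fin (n + 1) × Fin (n + (m + 1)) // ¬ IsTail p}) => x i :=
      measurable_pi_lambda _ fun i => measurable_pi_apply _
    refine MeasurableSet.inter (hres hVm) ?_
    have hi : {x : Fin (n + 1) × Fin (n + (m + 1)) → ℂ |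
        ∀ i : {p : Fin (n + 1) × Fin (n + (m + 1)) // IsTail p}, x i ∈ Metric.closedBall
          (singularTail (fun i : {p : Fin (n + 1) × Fin (n + (m + 1)) // ¬ IsTail p} => x i) i) r}
        = ⋂ i : {p : Fin (n + 1) × Fin (n + (m + 1)) // IsTail p},
          {x : Fin (n + 1) × Fin (n + (m + 1)) → ℂ | dist (x i) (singularTail
            (fun i : {p : Fin (n + 1) × Fin (n + (m + 1)) // ¬ IsTail p} => x i) i) ≤ r} := by
      ext x; simp
    refine (MeasurableSet.iInter fun i => ?_ : MeasurableSet (⋂ i, _)).congr hi.symm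
    exact measurableSet_le (Measurable.dist (measurable_pi_apply _)
      ((measurable_pi_apply i).comp (measurable_singularTail.comp hres))) measurable_const
  have hsub : {ω | (fun p : Fin (n + 1) × Fin (n + (m + 1)) => H ω p.1 p.2) ∈ S}
      ⊆ {ω | ∑ k, Real.logb 2 (1 + sinrWienerZF ρ (H ω) k) ≤ R} := by
    rintro ω ⟨hω1, hω2⟩
    have hclose : ∀ p : Fin (n + 1) × Fin (n + (m + 1)), ¬ IsTail p →
        ‖H ω p.1 p.2 - baseEntry n m p‖ ≤ η := fun p hp => by
      have := hω1 ⟨p, hp⟩ (Set.mem_univ _)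
      rwa [Metric.mem_closedBall, dist_eq_norm] at this
    obtain ⟨w, hw1, hw⟩ := exists_almost_null (r := r)
      (x := fun p : Fin (n + 1) × Fin (n + (m + 1)) => H ω p.1 p.2) hη8 hclose
      (fun p => by have := hω2 p; rwa [Metric.mem_closedBall, dist_eq_norm] at this)
    refine outage_of_spread (Nat.le_add_left 1 n) hρ0 (t := t) (w := w) le_rfl
      (fun h => by simp [h] at hw1) ?_ ?_
    · refine hw.trans ?_
      rw [hr2]
      have h1 : (1 : ℝ) ≤ ∑ k, ‖w k‖ ^ 2 := by
        have := Finset.single_le_sum (f := fun k => ‖w k‖ ^ 2) (fun k _ => by positivity)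
          (Finset.mem_univ (Fin.last n))
        simpa [hw1] using this
      calc ((m : ℝ) + 1) * (t * N / (m + 1) / ρ) = t * (N / ρ) := by field_simp
        _ ≤ _ := le_mul_of_one_le_right (by positivity) h1
    · intro u hu hux k
      exact spread_of_close (x := fun p : Fin (n + 1) × Fin (n + (m + 1)) => H ω p.1 p.2)
        (Real.sqrt_nonneg _) le_rfl he8 hclose hu (hux.trans he2.ge) k
  have hlow := le_pi_measure_discs (q := IsTail (n := n) (m := m)) stdComplexGaussian
    measurable_singularTail hVm (r := r) (b := ENNReal.ofReal (c * r ^ 2)) (fun y hy i => by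
      refine hball _ r (norm_singularTail_le hη8 (fun p => ?_) i) hr0 hr1
      have := hy p (Set.mem_univ _)
      rwa [Metric.mem_closedBall, dist_eq_norm] at this)
  have hP : Measure.pi (fun _ => stdComplexGaussian) S
      ≤ P {ω | ∑ k, Real.logb 2 (1 + sinrWienerZF ρ (H ω) k) ≤ R} := by
    rw [← hH.measure_eq hSmeas]
    exact measure_mono hsub
  have hfin := ENNReal.toReal_mono (measure_ne_top P _) (hlow.trans hP)
  rw [ENNReal.toReal_mul, ENNReal.toReal_pow, ENNReal.toReal_ofReal (by positivity), card_isTail,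
    hr2] at hfin
  refine le_trans (le_of_eq ?_) hfin
  rw [← mul_div_assoc c (t * N / (m + 1)) ρ, div_pow]
  exact (div_mul_eq_mul_div _ _ _).symm

theorem le_outageProb {N M : ℕ} {H : Ω → Matrix (Fin N) (Fin M) ℂ} (hN : 1 ≤ N) (hNM : N ≤ M)
    (hH : IsGaussianChannel H P) {R : ℝ} (hR : 0 < R) :
    ∃ C ρ₀ : ℝ, 0 < C ∧ 0 < ρ₀ ∧ ∀ ρ : ℝ, ρ₀ ≤ ρ →
      C / ρ ^ (M - N + 1) ≤ outageProb P (fun ω k => sinrWienerZF ρ (H ω) k) R := by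
  obtain ⟨n, rfl⟩ : ∃ n, N = n + 1 := ⟨N - 1, by omega⟩
  obtain ⟨m, rfl⟩ : ∃ m, M = n + (m + 1) := ⟨M - n - 1, by omega⟩
  have h : n + (m + 1) - (n + 1) + 1 = m + 1 := by omega
  rw [h]
  exact le_outageProb_aux hH hR

end LowerBound

/-! ### Exponents from two-sided power bounds. -/

section Asymptotics

lemma tendsto_log_const_mul_rpow_div_log {C : ℝ} (hC : 0 < C) (a : ℝ) :
    Tendsto (fun ρ : ℝ => Real.log (C * ρ ^ a) / Real.log ρ) atTop (𝓝 a) := by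
  have h : Tendsto (fun ρ : ℝ => Real.log C / Real.log ρ + a) atTop (𝓝 (0 + a)) :=
    (Real.tendsto_log_atTop.const_div_atTop _).add_const a
  rw [zero_add] at h
  refine h.congr' ?_
  filter_upwards [eventually_gt_atTop 1] with ρ hρ
  have h0 : 0 < ρ := by linarith
  have hl : Real.log ρ ≠ 0 := (Real.log_pos hρ).ne'
  rw [Real.log_mul hC.ne' (Real.rpow_pos_of_pos h0 _).ne', Real.log_rpow h0]
  field_simp

/-- A function squeezed between `C ρ ^ a` and `C' ρ ^ (a + ε)` for every `ε > 0` has exponent `a`. -/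
lemma tendsto_log_div_log_of_bounds {f : ℝ → ℝ} {a : ℝ}
    (hlow : ∃ C : ℝ, 0 < C ∧ ∀ᶠ ρ in atTop, C * ρ ^ a ≤ f ρ)
    (hup : ∀ ε : ℝ, 0 < ε → ∃ C : ℝ, 0 < C ∧ ∀ᶠ ρ in atTop, f ρ ≤ C * ρ ^ (a + ε)) :
    Tendsto (fun ρ => Real.log (f ρ) / Real.log ρ) atTop (𝓝 a) := by
  obtain ⟨C, hC, hlow⟩ := hlow
  rw [tendsto_order]
  constructor
  · intro b hb
    filter_upwards [(tendsto_order.mp (tendsto_log_const_mul_rpow_div_log hC a)).1 b hb, hlow,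
      eventually_gt_atTop 1] with ρ h1 h2 hρ
    refine h1.trans_le ?_
    have h0 : 0 < ρ := by linarith
    have := Real.log_pos hρ
    gcongr
  · intro b hb
    obtain ⟨C', hC', hup⟩ := hup ((b - a) / 2) (by linarith)
    filter_upwards [(tendsto_order.mp (tendsto_log_const_mul_rpow_div_log hC'
      (a + (b - a) / 2))).2 b (by linarith), hlow, hup, eventually_gt_atTop 1] with ρ h1 h2 h3 hρ
    refine lt_of_le_of_lt ?_ h1
    have h0 : 0 < ρ := by linarith
    have := Real.log_pos hρ
    -- Monotonicity of the logarithm needs `f ρ > 0`, so the lower bound enters here too.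
    have hf : 0 < f ρ := lt_of_lt_of_le (by positivity) h2
    gcongr

end Asymptotics

end MIMO

/-! ### The diversity theorem. -/

theorem mainTheorem7 {Ω : Type*} [MeasurableSpace Ω] (P : Measure Ω) [IsProbabilityMeasure P]
    (M N : ℕ) (hN : 1 ≤ N) (hNM : N ≤ M)
    (H : Ω → Matrix (Fin N) (Fin M) ℂ) (hH : MIMO.IsGaussianChannel H P)
    (R : ℝ) (hR : 0 < R) :
    MIMO.ExpEq (fun ρ => MIMO.outageProb P (fun ω k => MIMO.sinrWienerZF ρ (H ω) k) R)
      (fun ρ => ρ ^ (-((M : ℝ) - (N : ℝ) + 1))) ∧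
    MIMO.HasDiversity
      (fun ρ => MIMO.outageProb P (fun ω k => MIMO.sinrWienerZF ρ (H ω) k) R)
      ((M : ℝ) - (N : ℝ) + 1) := by
  set f : ℝ → ℝ := fun ρ => MIMO.outageProb P (fun ω k => MIMO.sinrWienerZF ρ (H ω) k) R with hf
  set d : ℝ := (M : ℝ) - (N : ℝ) + 1 with hd
  have hdn : ((M - N + 1 : ℕ) : ℝ) = d := by rw [hd]; push_cast [Nat.cast_sub hNM]; rfl
  have hd0 : 0 < d := by rw [← hdn]; positivity
  have hpow : ∀ ρ : ℝ, 0 < ρ → (ρ ^ (M - N + 1))⁻¹ = ρ ^ (-d) := fun ρ hρ => by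
    rw [Real.rpow_neg hρ.le, ← hdn, Real.rpow_natCast]
  have hlow : ∃ C : ℝ, 0 < C ∧ ∀ᶠ ρ in atTop, C * ρ ^ (-d) ≤ f ρ := by
    obtain ⟨C, ρ₀, hC, hρ₀, h⟩ := MIMO.le_outageProb hN hNM hH hR
    refine ⟨C, hC, ?_⟩
    filter_upwards [eventually_ge_atTop ρ₀] with ρ hρ
    rw [← hpow ρ (hρ₀.trans_le hρ), ← div_eq_mul_inv]
    exact h ρ hρ
  have hM0 : (0 : ℝ) < M := by exact_mod_cast hN.trans hNM
  have hup : ∀ ε : ℝ, 0 < ε → ∃ C : ℝ, 0 < C ∧ ∀ᶠ ρ in atTop, f ρ ≤ C * ρ ^ (-d + ε) := by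
    intro ε hε
    -- With `K = ρ ^ (ε / (2 M))` the factor `K ^ (2 M)` costs only `ρ ^ ε`, and this `p` makes the
    -- tail `1 / K ^ p` at most `ρ ^ (-d)`.
    obtain ⟨p, hp⟩ := exists_nat_ge (d / (ε / (2 * M)))
    rw [div_le_iff₀ (by positivity)] at hp
    obtain ⟨C, ρ₀, hC, hρ₀, h⟩ := MIMO.outageProb_le hN hNM hH hR p
    refine ⟨2 * C, by positivity, ?_⟩
    filter_upwards [eventually_ge_atTop ρ₀, eventually_ge_atTop 1] with ρ hρ hρ1
    have h0 : 0 < ρ := by linarith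
    refine (h ρ (ρ ^ (ε / (2 * M))) hρ (Real.one_le_rpow hρ1 (by positivity))).trans ?_
    have h1 : (ρ ^ (ε / (2 * M))) ^ (2 * M) / ρ ^ (M - N + 1) = ρ ^ (-d + ε) := by
      rw [div_eq_mul_inv, hpow ρ h0, ← Real.rpow_natCast, ← Real.rpow_mul h0.le,
        ← Real.rpow_add h0]
      congr 1
      push_cast
      field_simp
      ring
    have h2 : 1 / (ρ ^ (ε / (2 * M))) ^ p ≤ ρ ^ (-d + ε) := by
      rw [← Real.rpow_natCast, ← Real.rpow_mul h0.le, one_div, ← Real.rpow_neg h0.le]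
      exact Real.rpow_le_rpow_of_exponent_le hρ1 (by linarith)
    rw [h1, mul_comm 2 C, mul_assoc]
    gcongr
    linarith
  have hlim := MIMO.tendsto_log_div_log_of_bounds hlow hup
  have hpos : ∀ᶠ ρ in atTop, 0 < f ρ := by
    obtain ⟨C, hC, hlow⟩ := hlow
    filter_upwards [hlow, eventually_gt_atTop 0] with ρ h h0
    exact lt_of_lt_of_le (by positivity) h
  refine ⟨⟨hpos, ?_, -d, hlim, ?_⟩, hpos, by simpa using hlim.neg⟩
  · filter_upwards [eventually_gt_atTop 0] with ρ h0
    positivity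
  · simpa using MIMO.tendsto_log_const_mul_rpow_div_log one_pos (-d)
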